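/- Let $n\ge 0$ and $a_1,\dots,a_n>0$. On $\mathbb R^{2n}$ with coordinates $Z=(Z_1,\dots,Z_{2n})$ consider the symplectic form $\omega_a=\sum_{k=1}^n a_k\,dZ_{2k-1}\wedge dZ_{2k}$ and the one-form $\alpha=\sum_{k=1}^n\frac{a_k}{2}(Z_{2k-1}\,dZ_{2k}-Z_{2k}\,dZ_{2k-1})$, so that $d\alpha=\omega_a$. Let $V$ be a finite-dimensional Hermitian vector space (for instance $V=\mathbb C$), and let $$\mathcal H=(d-i\alpha)^*(d-i\alpha)=-\sum_{j=1}^{2n}\Big(\frac{\partial}{\partial Z_j}-i\alpha_j\Big)^2$$ be the magnetic Laplacian acting on $V$-valued functions on $\mathbb R^{2n}$. Let $\Lambda=\sum_{j=1}^n(2k_j+1)a_j$ with $k_1,\dots,k_n\in\mathbb Z_{\ge 0}$ be a Landau level, and let $\mathcal P_\Lambda$ be the orthogonal projection of $L^2(\mathbb R^{2n},V)$ onto the eigenspace $\{\Phi\in L^2(\mathbb R^{2n},V):\mathcal H\Phi=\Lambda\Phi\}$, the equation being understood in the sense of distributions. For a function $F$ on $\mathbb R^{2n}$ let $X_F$ be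 its Hamiltonian vector field, $\omega_a(X_F,\cdot)=dF$, and let $\{F,G\}_a=X_F(G)$ be the Poisson bracket, that is, $$\{F,G\}_a=\sum_{k=1}^n\frac1{a_k}\Big(\frac{\partial F}{\partial Z_{2k}}\frac{\partial G}{\partial Z_{2k-1}}-\frac{\partial F}{\partial Z_{2k-1}}\frac{\partial G}{\partial Z_{2k}}\Big).$$ Let $\mathcal P_\Lambda F\mathcal P_\Lambda$ denote the (in general unbounded) operator in $L^2(\mathbb R^{2n},V)$ with domain $\{\Phi: F\,\mathcal P_\Lambda\Phi\in L^2\}$; products and differences of unbounded operators carry their natural maximal domains. Then, for all real-linear functions $F,G:\mathbb R^{2n}\to\mathbb C$ (in particular for real-valued ones), $\{F,G\}_a$ is a constant, the domain of the commutator $[\mathcal P_\Lambda F\mathcal P_\Lambda,\mathcal P_\Lambda G\mathcal P_\Lambda]$ contains all Schwartz functions $\mathbb R^{2n}\to V$, and on the whole domain of the commutator $$[\mathcal P_\Lambda F\mathcal P_\Lambda,\ \mathcal P_\Lambda G\mathcal P_\Lambda]=i\,\{F,G\}_a\,\mathcal P_\Lambda .$$ -/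

import Mathlib

open MeasureTheory
open scoped SchwartzMap LineDeriv

noncomputable section

namespace Landau

/-- The space `ℝ^{2n}` with its Euclidean structure and Lebesgue measure. The coordinate
`Z_{2k-1}` is `Z (k, 0)` and the coordinate `Z_{2k}` is `Z (k, 1)`, where `k` runs over `Fin n`. -/
abbrev Space (n : ℕ) : Type := EuclideanSpace ℝ (Fin n × Fin 2)

/-- The coordinate vector field `∂/∂Z_i`. -/
def basisVec {n : ℕ} (i : Fin n × Fin 2) : Space n := EuclideanSpace.single i 1

/-! ### The symplectic form and the Poisson bracket -/

/-- The symplectic form `ω_a = ∑ a_k dZ_{2k-1} ∧ dZ_{2k}`, extended complex bilinearly to the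
complexified tangent space. -/
def omega {n : ℕ} (a : Fin n → ℝ) (X Y : Fin n × Fin 2 → ℂ) : ℂ :=
  ∑ k, (a k : ℂ) * (X (k, 0) * Y (k, 1) - X (k, 1) * Y (k, 0))

/-- The Hamiltonian vector field `X_F` of a (complex valued) function `F`, determined by
`ω_a(X_F, v) = dF(v)`; see `omega_eq_fderiv_iff`. -/
def hamVec {n : ℕ} (a : Fin n → ℝ) (F : Space n → ℂ) (Z : Space n) : Fin n × Fin 2 → ℂ :=
  fun i =>
    if i.2 = 0 then fderiv ℝ F Z (basisVec (i.1, 1)) / (a i.1 : ℂ)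
    else -(fderiv ℝ F Z (basisVec (i.1, 0)) / (a i.1 : ℂ))

/-- The Poisson bracket `{F, G}_a = X_F(G) = dG(X_F)` of the symplectic manifold
`(ℝ^{2n}, ω_a)`. -/
def poissonBracket {n : ℕ} (a : Fin n → ℝ) (F G : Space n → ℂ) (Z : Space n) : ℂ :=
  ∑ i, hamVec a F Z i * fderiv ℝ G Z (basisVec i)

theorem eq_sum_basisVec {n : ℕ} (v : Space n) : v = ∑ i, v i • basisVec i := by
  ext j
  simp only [basisVec, WithLp.ofLp_sum, WithLp.ofLp_smul, Finset.sum_apply, Pi.smul_apply,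
    PiLp.single_apply, smul_eq_mul, mul_ite, mul_one, mul_zero]
  simp

/-- `hamVec a F Z` is the unique complex tangent vector `X` with `ω_a(X, ·) = dF_Z`. -/
theorem omega_eq_fderiv_iff {n : ℕ} (a : Fin n → ℝ) (ha : ∀ k, 0 < a k) (F : Space n → ℂ)
    (Z : Space n) (X : Fin n × Fin 2 → ℂ) :
    (∀ v : Space n, omega a X (fun i => (v i : ℂ)) = fderiv ℝ F Z v) ↔ X = hamVec a F Z := by
  have hne : ∀ k, (a k : ℂ) ≠ 0 := fun k => by exact_mod_cast (ha k).ne'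
  constructor
  · intro h
    funext ⟨k, j⟩
    have h0 := h (basisVec (k, 0))
    have h1 := h (basisVec (k, 1))
    simp only [omega, basisVec, PiLp.single_apply, Prod.mk.injEq] at h0 h1
    rw [Finset.sum_eq_single k (by intro b _ hb; simp [hb]) (by simp)] at h0 h1
    simp at h0 h1
    fin_cases j
    · simp only [hamVec, basisVec, Fin.zero_eta, if_true, ← h1]
      field_simp [hne k]
    · simp only [hamVec, basisVec, Fin.mk_one, one_ne_zero, if_false, ← h0]
      field_simp [hne k]
  · rintro rfl v
    conv_rhs => rw [eq_sum_basisVec v, map_sum, Fintype.sum_prod_type]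
    refine Finset.sum_congr rfl fun k _ => ?_
    have := hne k
    simp [hamVec, Fin.sum_univ_two, map_smul]
    field_simp
    ring

/-! ### The model magnetic Laplacian -/

/-- The component `α_i` of the connection form
`α = ∑ (a_k / 2) (Z_{2k-1} dZ_{2k} - Z_{2k} dZ_{2k-1})`, a primitive of `ω_a`. -/
def potential {n : ℕ} (a : Fin n → ℝ) (i : Fin n × Fin 2) (Z : Space n) : ℝ :=
  if i.2 = 0 then -(a i.1 / 2 * Z (i.1, 1)) else a i.1 / 2 * Z (i.1, 0)

theorem hasTemperateGrowth_potential {n : ℕ} (a : Fin n → ℝ) (i : Fin n × Fin 2) :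
    (fun Z : Space n => (potential a i Z : ℂ)).HasTemperateGrowth := by
  obtain ⟨k, j⟩ := i
  let L (c : ℝ) (l : Fin n × Fin 2) : Space n →L[ℝ] ℂ :=
    Complex.ofRealCLM.comp (c • (EuclideanSpace.proj l : Space n →L[ℝ] ℝ))
  fin_cases j
  · convert (L (-(a k / 2)) (k, 1)).hasTemperateGrowth using 2 with Z
    simp [L, potential]
  · convert (L (a k / 2) (k, 0)).hasTemperateGrowth using 2 with Z
    simp [L, potential]

section Operators

variable {n : ℕ} {V : Type*} [NormedAddCommGroup V] [InnerProductSpace ℂ V]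

/-- The component `∇_i = ∂/∂Z_i - i α_i` of the covariant derivative `d - i α`, on Schwartz
functions; see `covDeriv_apply`. -/
def covDeriv (a : Fin n → ℝ) (i : Fin n × Fin 2) : 𝓢(Space n, V) →ₗ[ℂ] 𝓢(Space n, V) where
  toFun ψ := ∂_{basisVec i} ψ
    - Complex.I • SchwartzMap.smulLeftCLM V (fun Z => (potential a i Z : ℂ)) ψ
  map_add' ψ φ := by
    simp only [LineDeriv.lineDerivOp_add, map_add, smul_add]
    abel
  map_smul' c ψ := by
    simp only [LineDeriv.lineDerivOp_smul, map_smul, RingHom.id_apply, smul_sub]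
    rw [smul_comm]

theorem covDeriv_apply (a : Fin n → ℝ) (i : Fin n × Fin 2) (ψ : 𝓢(Space n, V)) (Z : Space n) :
    covDeriv a i ψ Z
      = fderiv ℝ ψ Z (basisVec i) - (Complex.I * (potential a i Z : ℂ)) • ψ Z := by
  simp [covDeriv, SchwartzMap.smulLeftCLM_apply_apply (hasTemperateGrowth_potential a i),
    SchwartzMap.lineDerivOp_apply_eq_fderiv, mul_smul]

/-- The magnetic (Bochner) Laplacian `(d - iα)^* (d - iα) = -∑ ∇_i ∇_i` on Schwartz functions. -/
def magneticLaplacian (a : Fin n → ℝ) : 𝓢(Space n, V) →ₗ[ℂ] 𝓢(Space n, V) :=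
  -∑ i, covDeriv a i ∘ₗ covDeriv a i

/-- The set `Σ` of Landau levels `Λ_𝐤 = ∑ (2 k_j + 1) a_j`. -/
def landauLevels (a : Fin n → ℝ) : Set ℝ :=
  {Λ | ∃ k : Fin n → ℕ, Λ = ∑ j, (2 * (k j : ℝ) + 1) * a j}

/-- The Hilbert space `L²(ℝ^{2n}, V)`. -/
abbrev L2 (n : ℕ) (V : Type*) [NormedAddCommGroup V] : Type _ :=
  Lp V 2 (volume : Measure (Space n))

/-- The eigenspace in `L²(ℝ^{2n}, V)` of the magnetic Laplacian for the eigenvalue `Λ`: the square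
integrable functions `Φ` with `𝓗 Φ = Λ Φ` in the sense of (tempered) distributions. The magnetic
Laplacian is symmetric on Schwartz functions, so this says that `Φ` is an eigenvector of the
adjoint of `𝓗` with domain the Schwartz functions, which is its self-adjoint realization. -/
def eigenspace (V : Type*) [NormedAddCommGroup V] [InnerProductSpace ℂ V] (a : Fin n → ℝ) (Λ : ℝ) :
    Submodule ℂ (L2 n V) where
  carrier := {Φ | ∀ ψ : 𝓢(Space n, V),
    inner ℂ ((magneticLaplacian a ψ).toLp 2) Φ = (Λ : ℂ) * inner ℂ (ψ.toLp 2) Φ}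
  add_mem' {Φ Φ'} h h' ψ := by
    simp only [inner_add_right, h ψ, h' ψ, mul_add]
  zero_mem' ψ := by simp
  smul_mem' c Φ h ψ := by
    simp only [inner_smul_right, h ψ]
    ring

theorem isClosed_eigenspace (a : Fin n → ℝ) (Λ : ℝ) :
    IsClosed (eigenspace V a Λ : Set (L2 n V)) := by
  have : (eigenspace V a Λ : Set (L2 n V)) = ⋂ ψ : 𝓢(Space n, V), {Φ |
      inner ℂ ((magneticLaplacian a ψ).toLp 2) Φ = (Λ : ℂ) * inner ℂ (ψ.toLp 2) Φ} := by
    ext Φ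
    simp [eigenspace]
  rw [this]
  exact isClosed_iInter fun ψ => isClosed_eq (by fun_prop) (by fun_prop)

instance hasOrthogonalProjection_eigenspace [FiniteDimensional ℂ V] (a : Fin n → ℝ) (Λ : ℝ) :
    (eigenspace V a Λ).HasOrthogonalProjection := by
  have : CompleteSpace V := FiniteDimensional.complete ℂ V
  have : CompleteSpace (eigenspace V a Λ) :=
    (isClosed_eigenspace a Λ).completeSpace_coe
  infer_instance

/-- The orthogonal projection `𝒫_Λ` of `L²(ℝ^{2n}, V)` onto the eigenspace for `Λ`. -/
def spectralProj (V : Type*) [NormedAddCommGroup V] [InnerProductSpace ℂ V]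
    [FiniteDimensional ℂ V] (a : Fin n → ℝ) (Λ : ℝ) : L2 n V →L[ℂ] L2 n V :=
  (eigenspace V a Λ).starProjection

/-! ### Unbounded operators -/

/-- The maximal domain `{Φ ∈ L² | F Φ ∈ L²}` of the multiplication by `F`. -/
def mulDomain (V : Type*) [NormedAddCommGroup V] [InnerProductSpace ℂ V] (F : Space n → ℂ) :
    Submodule ℂ (L2 n V) where
  carrier := {Φ | MemLp (fun Z => F Z • Φ Z) 2 volume}
  add_mem' {Φ Φ'} h h' := by
    refine MemLp.ae_eq ?_ (MemLp.add h h')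
    filter_upwards [Lp.coeFn_add Φ Φ'] with Z hZ
    rw [hZ, Pi.add_apply, Pi.add_apply, smul_add]
  zero_mem' := by
    refine MemLp.ae_eq ?_ (MemLp.zero' (p := 2))
    filter_upwards [Lp.coeFn_zero V 2 (volume : Measure (Space n))] with Z hZ
    rw [hZ, Pi.zero_apply, smul_zero]
  smul_mem' c Φ h := by
    refine MemLp.ae_eq ?_ (MemLp.const_smul h c)
    filter_upwards [Lp.coeFn_smul c Φ] with Z hZ
    rw [hZ, Pi.smul_apply, Pi.smul_apply, smul_comm]

theorem memLp_of_mem_mulDomain {F : Space n → ℂ} {Φ : L2 n V} (h : Φ ∈ mulDomain V F) :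
    MemLp (fun Z => F Z • Φ Z) 2 (volume : Measure (Space n)) := h

/-- The operator of multiplication by `F` in `L²`, on its maximal domain. -/
def mulOp (V : Type*) [NormedAddCommGroup V] [InnerProductSpace ℂ V] (F : Space n → ℂ) :
    L2 n V →ₗ.[ℂ] L2 n V where
  domain := mulDomain V F
  toFun :=
    { toFun := fun Φ =>
        MemLp.toLp (fun Z => F Z • (Φ : L2 n V) Z) (memLp_of_mem_mulDomain Φ.2)
      map_add' := fun Φ Φ' => by
        apply Lp.ext
        filter_upwards [MemLp.coeFn_toLp (memLp_of_mem_mulDomain (Φ + Φ').2),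
          MemLp.coeFn_toLp (memLp_of_mem_mulDomain Φ.2),
          MemLp.coeFn_toLp (memLp_of_mem_mulDomain Φ'.2),
          Lp.coeFn_add (MemLp.toLp _ (memLp_of_mem_mulDomain Φ.2))
            (MemLp.toLp _ (memLp_of_mem_mulDomain Φ'.2)),
          Lp.coeFn_add (Φ : L2 n V) (Φ' : L2 n V)] with Z h1 h2 h3 h4 h5
        rw [h1, h4, Pi.add_apply, h2, h3, Submodule.coe_add, h5, Pi.add_apply, smul_add]
      map_smul' := fun c Φ => by
        apply Lp.ext
        filter_upwards [MemLp.coeFn_toLp (memLp_of_mem_mulDomain (c • Φ).2),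
          MemLp.coeFn_toLp (memLp_of_mem_mulDomain Φ.2),
          Lp.coeFn_smul c (MemLp.toLp _ (memLp_of_mem_mulDomain Φ.2)),
          Lp.coeFn_smul c (Φ : L2 n V)] with Z h1 h2 h3 h4
        rw [h1, RingHom.id_apply, h3, Pi.smul_apply, h2, Submodule.coe_smul, h4, Pi.smul_apply,
          smul_comm] }

/-- The product `A B` of two partially defined operators, on its maximal domain
`{x ∈ dom B | B x ∈ dom A}`. -/
def pmul {H : Type*} [AddCommGroup H] [Module ℂ H] (A B : H →ₗ.[ℂ] H) : H →ₗ.[ℂ] H where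
  domain :=
    { carrier := {x | ∃ hx : x ∈ B.domain, B ⟨x, hx⟩ ∈ A.domain}
      add_mem' := by
        rintro x y ⟨hx, hx'⟩ ⟨hy, hy'⟩
        refine ⟨B.domain.add_mem hx hy, ?_⟩
        have := A.domain.add_mem hx' hy'
        rwa [← LinearPMap.map_add] at this
      zero_mem' := by
        refine ⟨B.domain.zero_mem, ?_⟩
        have : B ⟨0, B.domain.zero_mem⟩ = 0 := LinearPMap.map_zero B
        rw [this]
        exact A.domain.zero_mem
      smul_mem' := by
        rintro c x ⟨hx, hx'⟩
        refine ⟨B.domain.smul_mem c hx, ?_⟩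
        have := A.domain.smul_mem c hx'
        rwa [← LinearPMap.map_smul] at this }
  toFun :=
    { toFun := fun x => A ⟨B ⟨x, x.2.choose⟩, x.2.choose_spec⟩
      map_add' := fun x y => by
        rw [← LinearPMap.map_add]
        congr 1
        apply Subtype.ext
        exact LinearPMap.map_add B ⟨x, x.2.choose⟩ ⟨y, y.2.choose⟩
      map_smul' := fun c x => by
        rw [RingHom.id_apply, ← LinearPMap.map_smul]
        congr 1
        apply Subtype.ext
        exact LinearPMap.map_smul B c ⟨x, x.2.choose⟩ }

/-- The commutator `[A, B] = A B - B A` of two partially defined operators, with domain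
`dom (A B) ∩ dom (B A)`. -/
def commutator {H : Type*} [AddCommGroup H] [Module ℂ H] (A B : H →ₗ.[ℂ] H) : H →ₗ.[ℂ] H :=
  pmul A B - pmul B A

/-- The Toeplitz operator `𝒫_Λ F 𝒫_Λ` in `L²(ℝ^{2n}, V)`, with domain the set of all `Φ` such that
`F 𝒫_Λ Φ` is square integrable. -/
def toeplitz (V : Type*) [NormedAddCommGroup V] [InnerProductSpace ℂ V]
    [FiniteDimensional ℂ V] (a : Fin n → ℝ) (Λ : ℝ) (F : Space n → ℂ) : L2 n V →ₗ.[ℂ] L2 n V :=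
  let P : L2 n V →ₗ.[ℂ] L2 n V := (spectralProj V a Λ : L2 n V →ₗ[ℂ] L2 n V).toPMap ⊤
  pmul P (pmul (mulOp V F) P)

end Operators

end Landau

end

noncomputable section

namespace Landau

/-! ### Commutation relations and adjoints on Schwartz functions -/

section Algebra

variable {n : ℕ} {V : Type*} [NormedAddCommGroup V] [InnerProductSpace ℂ V]

/-! Write `∇_i` for the covariant derivatives, `H = -∑ ∇_i²` and `P` for the projection. For linear
`F`, the guiding centre operator `F + i ∇_{X_F}` commutes with every `∇_i`: the term `F(e_i)` from
the Leibniz rule is cancelled by the curvature, by definition of `X_F`. Hence it commutes with `H`.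
On the other hand `[H, Z_i] = -2 ∇_i`, so `P ∇_i P = 0`. Thus `P F P` is the guiding centre operator
compressed to the eigenspace, and two guiding centre operators satisfy `[·, ·] = i {F, G}_a`
(`covDeriv_guiding`, `spectralProj_covDeriv`, `guiding_comm`).

Eigenfunctions in `L²` are only weak solutions and `F` is unbounded, so these identities are moved
onto test functions: polynomials times the Gaussian ground state. They are total in `L²` because
moments determine functions of exponential decay (`ae_eq_zero_of_moments`). Those of degree at most
`d` form a finite-dimensional space preserved by the symmetric operator `H`, so they are spanned by
Schwartz eigenfunctions (`polyGauss_le_span_eigenvectors`).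

Schwartz eigenfunctions are therefore dense in the eigenspace, and `∑ ‖∇_i η‖² = Λ ‖η‖²` extends
`∇_i` and `P ∇_i P = 0` to all of it (`exists_weak_covDeriv`). This identifies the Toeplitz operator
weakly on its whole domain (`inner_spectralProj_mulOp`). For Schwartz data the same identity, read
backwards, shows that `F P ψ` is square integrable (`spectralProj_emb_mem_mulDomain`). -/

theorem hasTemperateGrowth_linear (F : Space n →ₗ[ℝ] ℂ) : (F : Space n → ℂ).HasTemperateGrowth :=
  F.toContinuousLinearMap.hasTemperateGrowth

theorem fderiv_linear (F : Space n →ₗ[ℝ] ℂ) (Z v : Space n) : fderiv ℝ F Z v = F v :=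
  congrArg (fun L => L v) F.toContinuousLinearMap.hasFDerivAt.fderiv

/-- Multiplication of Schwartz functions by a real-linear function. -/
def mulLin (V : Type*) [NormedAddCommGroup V] [InnerProductSpace ℂ V] (F : Space n →ₗ[ℝ] ℂ) :
    𝓢(Space n, V) →ₗ[ℂ] 𝓢(Space n, V) :=
  (SchwartzMap.smulLeftCLM V (F : Space n → ℂ) : 𝓢(Space n, V) →L[ℂ] 𝓢(Space n, V))

@[simp]
theorem mulLin_apply (F : Space n →ₗ[ℝ] ℂ) (ψ : 𝓢(Space n, V)) (Z : Space n) :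
    mulLin V F ψ Z = F Z • ψ Z :=
  SchwartzMap.smulLeftCLM_apply_apply (hasTemperateGrowth_linear F) ψ Z

theorem lineDeriv_mulLin (v : Space n) (F : Space n →ₗ[ℝ] ℂ) (ψ : 𝓢(Space n, V)) :
    ∂_{v} (mulLin V F ψ) = mulLin V F (∂_{v} ψ) + F v • ψ := by
  ext Z
  have hF : HasFDerivAt F F.toContinuousLinearMap Z := F.toContinuousLinearMap.hasFDerivAt
  have h := hF.smul (ψ.hasFDerivAt Z)
  have he : (mulLin V F ψ : Space n → V) = fun Z => F Z • ψ Z := funext (mulLin_apply F ψ)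
  rw [SchwartzMap.lineDerivOp_apply_eq_fderiv, he]
  erw [h.fderiv]
  simp [SchwartzMap.lineDerivOp_apply_eq_fderiv]

theorem lineDeriv_comm (v w : Space n) (ψ : 𝓢(Space n, V)) :
    ∂_{v} (∂_{w} ψ) = ∂_{w} (∂_{v} ψ) := by
  ext Z
  have hs : IsSymmSndFDerivAt ℝ ψ Z :=
    (ψ.smooth 2).contDiffAt.isSymmSndFDerivAt (by simp)
  have key (u u' : Space n) : (∂_{u} (∂_{u'} ψ)) Z = fderiv ℝ (fderiv ℝ ψ) Z u u' := by
    have he : (∂_{u'} ψ : 𝓢(Space n, V)) = fun Z => fderiv ℝ ψ Z u' :=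
      funext fun Z => SchwartzMap.lineDerivOp_apply_eq_fderiv u' ψ Z
    rw [SchwartzMap.lineDerivOp_apply_eq_fderiv, he]
    have hd : DifferentiableAt ℝ (fderiv ℝ ψ) Z :=
      ((ψ.smooth 2).fderiv_right (m := 1) (by norm_num)).differentiable (by norm_num) Z
    rw [fderiv_clm_apply hd (differentiableAt_const u')]
    simp
  rw [key, key, hs.eq]

theorem mulLin_comm (F G : Space n →ₗ[ℝ] ℂ) (ψ : 𝓢(Space n, V)) :
    mulLin V F (mulLin V G ψ) = mulLin V G (mulLin V F ψ) := by
  ext Z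
  simp [smul_smul, mul_comm]

/-- The component `α_i` of the connection form as a real-linear function. -/
def potentialLin (a : Fin n → ℝ) (i : Fin n × Fin 2) : Space n →ₗ[ℝ] ℂ where
  toFun Z := (potential a i Z : ℂ)
  map_add' Z W := by
    simp only [potential, PiLp.add_apply]
    split_ifs <;> push_cast <;> ring
  map_smul' c Z := by
    simp only [potential, PiLp.smul_apply, smul_eq_mul, RingHom.id_apply, Complex.real_smul]
    split_ifs <;> push_cast <;> ring

theorem potentialLin_basisVec (a : Fin n → ℝ) (i j : Fin n × Fin 2) :
    potentialLin a i (basisVec j) = if i.1 = j.1 then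
      (if i.2 = 0 then (if j.2 = 0 then 0 else -((a i.1 : ℂ) / 2))
        else (if j.2 = 0 then (a i.1 : ℂ) / 2 else 0)) else 0 := by
  obtain ⟨k, s⟩ := i
  obtain ⟨l, t⟩ := j
  by_cases h : k = l <;> fin_cases s <;> fin_cases t <;>
    simp [potentialLin, potential, basisVec, h]

theorem covDeriv_eq (a : Fin n → ℝ) (i : Fin n × Fin 2) (ψ : 𝓢(Space n, V)) :
    covDeriv a i ψ = ∂_{basisVec i} ψ - Complex.I • mulLin V (potentialLin a i) ψ := rfl

theorem covDeriv_mulLin (a : Fin n → ℝ) (i : Fin n × Fin 2) (F : Space n →ₗ[ℝ] ℂ)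
    (ψ : 𝓢(Space n, V)) :
    covDeriv a i (mulLin V F ψ) = mulLin V F (covDeriv a i ψ) + F (basisVec i) • ψ := by
  simp only [covDeriv_eq, lineDeriv_mulLin, map_sub, map_smul, mulLin_comm F]
  abel

/-- The curvature of the connection `d - i α` is `-i ω_a`. -/
theorem covDeriv_comm (a : Fin n → ℝ) (i j : Fin n × Fin 2) (ψ : 𝓢(Space n, V)) :
    covDeriv a i (covDeriv a j ψ) = covDeriv a j (covDeriv a i ψ)
      - (Complex.I * (potentialLin a j (basisVec i) - potentialLin a i (basisVec j))) • ψ := by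
  have h (ψ : 𝓢(Space n, V)) : covDeriv a j ψ
      = ∂_{basisVec j} ψ - Complex.I • mulLin V (potentialLin a j) ψ := rfl
  rw [h ψ, map_sub, map_smul, covDeriv_mulLin, h, covDeriv_eq, covDeriv_eq]
  have hsub : ∂_{basisVec j} (∂_{basisVec i} ψ - Complex.I • mulLin V (potentialLin a i) ψ)
      = ∂_{basisVec j} (∂_{basisVec i} ψ)
        - Complex.I • ∂_{basisVec j} (mulLin V (potentialLin a i) ψ) := by
    simpa using map_sub (LineDeriv.lineDerivOpCLM ℂ 𝓢(Space n, V) (basisVec j)) (∂_{basisVec i} ψ)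
      (Complex.I • mulLin V (potentialLin a i) ψ)
  rw [hsub]
  simp only [lineDeriv_comm (basisVec i) (basisVec j), map_sub, map_smul, lineDeriv_mulLin]
  module

/-- The (constant) components of the Hamiltonian vector field of a real-linear function. -/
def hamLin (a : Fin n → ℝ) (F : Space n →ₗ[ℝ] ℂ) (i : Fin n × Fin 2) : ℂ := hamVec a F 0 i

theorem hamVec_eq_hamLin (a : Fin n → ℝ) (F : Space n →ₗ[ℝ] ℂ) (Z : Space n) :
    hamVec a F Z = hamLin a F := by
  funext i
  simp only [hamLin, hamVec, fderiv_linear]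

/-- The Poisson bracket of two real-linear functions, which is a constant. -/
def bracketLin (a : Fin n → ℝ) (F G : Space n →ₗ[ℝ] ℂ) : ℂ :=
  ∑ i, hamLin a F i * G (basisVec i)

theorem poissonBracket_eq_bracketLin (a : Fin n → ℝ) (F G : Space n →ₗ[ℝ] ℂ) (Z : Space n) :
    poissonBracket a F G Z = bracketLin a F G := by
  simp only [poissonBracket, bracketLin, hamVec_eq_hamLin, fderiv_linear]

theorem bracketLin_swap (a : Fin n → ℝ) (F G : Space n →ₗ[ℝ] ℂ) :
    bracketLin a G F = -bracketLin a F G := by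
  simp only [bracketLin, hamLin, hamVec, fderiv_linear, Fintype.sum_prod_type, Fin.sum_univ_two,
    ← Finset.sum_neg_distrib]
  refine Finset.sum_congr rfl fun k _ => ?_
  simp
  ring

/-- The difference of potentials is `∂_i α_j - ∂_j α_i = ω_a(e_i, e_j)`, so this is `ω_a(e_i, X_F) =
-dF(e_i)`. -/
theorem sum_hamLin_mul_curvature (a : Fin n → ℝ) (ha : ∀ k, 0 < a k) (F : Space n →ₗ[ℝ] ℂ)
    (i : Fin n × Fin 2) :
    ∑ j, hamLin a F j * (potentialLin a j (basisVec i) - potentialLin a i (basisVec j))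
      = -F (basisVec i) := by
  obtain ⟨k, s⟩ := i
  have hk : (a k : ℂ) ≠ 0 := by exact_mod_cast (ha k).ne'
  rw [Fintype.sum_prod_type, Finset.sum_eq_single k]
  · fin_cases s <;>
      simp [Fin.sum_univ_two, potentialLin_basisVec, hamLin, hamVec, fderiv_linear] <;>
      (field_simp; try ring)
  · intro b _ hb
    simp [potentialLin_basisVec, hb, hb.symm]
  · simp

/-- The operator `F + i ∇_{X_F}` on Schwartz functions. -/
def guiding (V : Type*) [NormedAddCommGroup V] [InnerProductSpace ℂ V] (a : Fin n → ℝ)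
    (F : Space n →ₗ[ℝ] ℂ) : 𝓢(Space n, V) →ₗ[ℂ] 𝓢(Space n, V) :=
  mulLin V F + ∑ j, (Complex.I * hamLin a F j) • covDeriv a j

theorem guiding_apply (a : Fin n → ℝ) (F : Space n →ₗ[ℝ] ℂ) (ψ : 𝓢(Space n, V)) :
    guiding V a F ψ = mulLin V F ψ + ∑ j, (Complex.I * hamLin a F j) • covDeriv a j ψ := by
  simp [guiding]

/-- Commuting `∇_i` past `F` produces `F(e_i)`; commuting it past `i ∇_{X_F}` produces `ω_a(e_i,
X_F) = -F(e_i)`. The two cancel. -/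
theorem covDeriv_guiding (a : Fin n → ℝ) (ha : ∀ k, 0 < a k) (F : Space n →ₗ[ℝ] ℂ)
    (i : Fin n × Fin 2) (ψ : 𝓢(Space n, V)) :
    covDeriv a i (guiding V a F ψ) = guiding V a F (covDeriv a i ψ) := by
  simp only [guiding_apply, map_add, map_sum, map_smul, covDeriv_mulLin]
  have h : ∑ j, (Complex.I * hamLin a F j) • covDeriv a i (covDeriv a j ψ)
      = ∑ j, (Complex.I * hamLin a F j) • covDeriv a j (covDeriv a i ψ) - F (basisVec i) • ψ := by
    rw [← neg_neg (F (basisVec i)), ← sum_hamLin_mul_curvature a ha F i, neg_smul, Finset.sum_smul,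
      sub_neg_eq_add, ← Finset.sum_add_distrib]
    refine Finset.sum_congr rfl fun j _ => ?_
    rw [covDeriv_comm, smul_sub, smul_smul, sub_eq_add_neg, ← neg_smul]
    congr 2
    linear_combination (-(hamLin a F j) * (potentialLin a j (basisVec i)
      - potentialLin a i (basisVec j))) * Complex.I_mul_I
  rw [h]
  abel

theorem magneticLaplacian_apply (a : Fin n → ℝ) (ψ : 𝓢(Space n, V)) :
    magneticLaplacian a ψ = -∑ i, covDeriv a i (covDeriv a i ψ) := by
  simp [magneticLaplacian]

theorem magneticLaplacian_guiding (a : Fin n → ℝ) (ha : ∀ k, 0 < a k) (F : Space n →ₗ[ℝ] ℂ)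
    (ψ : 𝓢(Space n, V)) :
    magneticLaplacian a (guiding V a F ψ) = guiding V a F (magneticLaplacian a ψ) := by
  simp only [magneticLaplacian_apply, covDeriv_guiding a ha, map_neg, map_sum]

/-- Two applications of the Leibniz rule; no second-order term in `F` appears because `F` is linear.
With `F = Z_i` it exhibits `∇_i` as a commutator with the Laplacian. -/
theorem magneticLaplacian_mulLin (a : Fin n → ℝ) (F : Space n →ₗ[ℝ] ℂ) (ψ : 𝓢(Space n, V)) :
    magneticLaplacian a (mulLin V F ψ) = mulLin V F (magneticLaplacian a ψ)
      - (2 : ℂ) • ∑ i, F (basisVec i) • covDeriv a i ψ := by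
  simp only [magneticLaplacian_apply, covDeriv_mulLin, map_neg, map_sum, map_add, map_smul,
    Finset.sum_add_distrib]
  module

/-- The guiding centre operators represent the Poisson bracket of linear functions. -/
theorem guiding_comm (a : Fin n → ℝ) (ha : ∀ k, 0 < a k) (F G : Space n →ₗ[ℝ] ℂ)
    (ψ : 𝓢(Space n, V)) :
    guiding V a F (guiding V a G ψ) - guiding V a G (guiding V a F ψ)
      = (Complex.I * bracketLin a F G) • ψ := by
  have hF := guiding_apply a F (guiding V a G ψ)
  have h2 : guiding V a G (guiding V a F ψ) = guiding V a G (mulLin V F ψ)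
      + ∑ j, (Complex.I * hamLin a F j) • guiding V a G (covDeriv a j ψ) := by
    rw [guiding_apply a F ψ, map_add, map_sum]
    simp only [map_smul]
  rw [hF, h2]
  -- The part `i ∇_{X_F}` commutes with the operator of `G`, so only the commutator of
  -- multiplication by `F` with `i ∇_{X_G}` survives; it is the scalar `-i dF(X_G)`.
  simp only [covDeriv_guiding a ha]
  rw [guiding_apply a G ψ, guiding_apply a G (mulLin V F ψ), map_add, map_sum, mulLin_comm F G]
  simp only [map_smul, covDeriv_mulLin, smul_add, Finset.sum_add_distrib, smul_smul]
  rw [← Finset.sum_smul]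
  have : ∑ i, Complex.I * hamLin a G i * F (basisVec i) = -(Complex.I * bracketLin a F G) := by
    rw [← mul_neg, ← bracketLin_swap, bracketLin, Finset.mul_sum]
    simp only [mul_assoc]
  rw [this]
  module

/-! ### Adjoints in `L²` -/

/-- The pointwise complex conjugate of a real-linear function. -/
def conjLin (F : Space n →ₗ[ℝ] ℂ) : Space n →ₗ[ℝ] ℂ := Complex.conjAe.toLinearMap ∘ₗ F

@[simp]
theorem conjLin_apply (F : Space n →ₗ[ℝ] ℂ) (Z : Space n) :
    conjLin F Z = (starRingEnd ℂ) (F Z) := rfl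

@[simp]
theorem conjLin_conjLin (F : Space n →ₗ[ℝ] ℂ) : conjLin (conjLin F) = F := by
  ext Z
  simp

theorem hamLin_conjLin (a : Fin n → ℝ) (F : Space n →ₗ[ℝ] ℂ) (i : Fin n × Fin 2) :
    hamLin a (conjLin F) i = (starRingEnd ℂ) (hamLin a F i) := by
  simp only [hamLin, hamVec, fderiv_linear, conjLin_apply]
  split_ifs <;> simp

theorem bracketLin_conjLin (a : Fin n → ℝ) (F G : Space n →ₗ[ℝ] ℂ) :
    bracketLin a (conjLin F) (conjLin G) = (starRingEnd ℂ) (bracketLin a F G) := by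
  simp [bracketLin, hamLin_conjLin, map_sum]

/-- The embedding of the Schwartz functions into `L²`. -/
def emb : 𝓢(Space n, V) →ₗ[ℂ] L2 n V :=
  (SchwartzMap.toLpCLM ℂ V 2 (volume : Measure (Space n)) : 𝓢(Space n, V) →L[ℂ] L2 n V)

theorem emb_apply (ψ : 𝓢(Space n, V)) : emb ψ = ψ.toLp 2 (volume : Measure (Space n)) := rfl

theorem inner_emb (ψ φ : 𝓢(Space n, V)) :
    inner ℂ (emb ψ) (emb φ) = ∫ Z, inner ℂ (ψ Z) (φ Z) :=
  SchwartzMap.inner_toL2_toL2_eq ψ φ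

theorem inner_emb_left (ψ : 𝓢(Space n, V)) (φ : L2 n V) :
    inner ℂ (emb ψ) φ = ∫ Z, inner ℂ (ψ Z) (φ Z) := by
  rw [L2.inner_def]
  refine integral_congr_ae ?_
  filter_upwards [ψ.coeFn_toLp 2 (volume : Measure (Space n))] with Z hZ
  rw [emb_apply, hZ]

theorem emb_injective : Function.Injective (emb : 𝓢(Space n, V) → L2 n V) :=
  SchwartzMap.injective_toLp 2 volume

theorem inner_mulLin_left (F : Space n →ₗ[ℝ] ℂ) (ψ φ : 𝓢(Space n, V)) :
    inner ℂ (emb (mulLin V F ψ)) (emb φ) = inner ℂ (emb ψ) (emb (mulLin V (conjLin F) φ)) := by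
  simp only [inner_emb, mulLin_apply, inner_smul_left, inner_smul_right, conjLin_apply]

theorem inner_lineDeriv_left (v : Space n) (ψ φ : 𝓢(Space n, V)) :
    inner ℂ (emb (∂_{v} ψ)) (emb φ) = -inner ℂ (emb ψ) (emb (∂_{v} φ)) := by
  simp only [inner_emb]
  have := SchwartzMap.integral_bilinear_lineDerivOp_right_eq_neg_left (μ := volume) ψ φ
    (isBoundedBilinearMap_inner (𝕜 := ℂ) (E := V)).toContinuousLinearMap v
  rw [eq_neg_iff_add_eq_zero, add_comm, ← eq_neg_iff_add_eq_zero]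
  exact this

theorem inner_covDeriv_left (a : Fin n → ℝ) (i : Fin n × Fin 2) (ψ φ : 𝓢(Space n, V)) :
    inner ℂ (emb (covDeriv a i ψ)) (emb φ) = -inner ℂ (emb ψ) (emb (covDeriv a i φ)) := by
  have hc : conjLin (potentialLin a i) = potentialLin a i := by
    ext Z
    simp [potentialLin]
  simp only [covDeriv_eq, map_sub, map_smul, inner_sub_left, inner_sub_right, inner_smul_left,
    inner_smul_right, inner_lineDeriv_left, inner_mulLin_left, hc, Complex.conj_I]
  ring

theorem inner_magneticLaplacian_left (a : Fin n → ℝ) (ψ φ : 𝓢(Space n, V)) :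
    inner ℂ (emb (magneticLaplacian a ψ)) (emb φ)
      = inner ℂ (emb ψ) (emb (magneticLaplacian a φ)) := by
  simp only [magneticLaplacian_apply, map_neg, map_sum, inner_neg_left, inner_neg_right, sum_inner,
    inner_sum, inner_covDeriv_left, neg_neg]

theorem inner_magneticLaplacian_self (a : Fin n → ℝ) (ψ : 𝓢(Space n, V)) :
    inner ℂ (emb ψ) (emb (magneticLaplacian a ψ))
      = ((∑ i, ‖emb (covDeriv a i ψ)‖ ^ 2 : ℝ) : ℂ) := by
  simp only [magneticLaplacian_apply, map_neg, map_sum, inner_neg_right, inner_sum,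
    ← Finset.sum_neg_distrib, ← inner_covDeriv_left]
  push_cast
  exact Finset.sum_congr rfl fun i _ => inner_self_eq_norm_sq_to_K _

theorem inner_guiding_left (a : Fin n → ℝ) (F : Space n →ₗ[ℝ] ℂ) (ψ φ : 𝓢(Space n, V)) :
    inner ℂ (emb (guiding V a F ψ)) (emb φ)
      = inner ℂ (emb ψ) (emb (guiding V a (conjLin F) φ)) := by
  simp only [guiding_apply, map_add, map_sum, map_smul, inner_add_left, inner_add_right, sum_inner,
    inner_sum, inner_smul_left, inner_smul_right, inner_mulLin_left, inner_covDeriv_left,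
    hamLin_conjLin, map_mul, Complex.conj_I]
  congr 1
  exact Finset.sum_congr rfl fun i _ => by ring

end Algebra

section Gaussian

variable {n : ℕ} {V : Type*} [NormedAddCommGroup V] [InnerProductSpace ℂ V]

/-! ### The Gaussian ground state -/

theorem exists_pow_mul_exp_le (N : ℕ) (c : ℝ) {m : ℝ} (hm : 0 < m) :
    ∃ C : ℝ, ∀ r : ℝ, 0 ≤ r → (1 + r) ^ N * Real.exp (c * r) * Real.exp (-(m * r ^ 2)) ≤ C := by
  refine ⟨(N.factorial : ℝ) * (2 / m) ^ N * Real.exp m * Real.exp (c ^ 2 / (2 * m)),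
    fun r hr => ?_⟩
  -- Half of the exponent `m r²` absorbs the power, through `1 + r ≤ 2 + r²` and `x ^ N / N! ≤ exp
  -- x`; the other half absorbs `exp (c r)` by completing the square.
  have h1 : (1 + r) ^ N ≤ (N.factorial : ℝ) * (2 / m) ^ N * Real.exp (m / 2 * (2 + r ^ 2)) := by
    have h0 : (0 : ℝ) ≤ m / 2 * (2 + r ^ 2) := by positivity
    have h2 := Real.pow_div_factorial_le_exp _ h0 N
    rw [div_le_iff₀ (by positivity), mul_pow] at h2
    calc (1 + r) ^ N ≤ (2 + r ^ 2) ^ N := by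
          refine pow_le_pow_left₀ (by linarith) ?_ N
          nlinarith [sq_nonneg (r - 1)]
      _ = (2 / m) ^ N * ((m / 2) ^ N * (2 + r ^ 2) ^ N) := by
          rw [← mul_assoc, ← mul_pow]
          field_simp
          simp
      _ ≤ (2 / m) ^ N * (Real.exp (m / 2 * (2 + r ^ 2)) * N.factorial) := by gcongr
      _ = _ := by ring
  have h2 : c * r ≤ m / 2 * r ^ 2 + c ^ 2 / (2 * m) := by
    have : m / 2 * r ^ 2 + c ^ 2 / (2 * m) - c * r = (m * r - c) ^ 2 / (2 * m) := by
      field_simp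
      ring
    have h3 : 0 ≤ (m * r - c) ^ 2 / (2 * m) := by positivity
    linarith
  calc (1 + r) ^ N * Real.exp (c * r) * Real.exp (-(m * r ^ 2))
      ≤ ((N.factorial : ℝ) * (2 / m) ^ N * Real.exp (m / 2 * (2 + r ^ 2)))
        * Real.exp (m / 2 * r ^ 2 + c ^ 2 / (2 * m)) * Real.exp (-(m * r ^ 2)) := by gcongr
    _ = (N.factorial : ℝ) * (2 / m) ^ N * (Real.exp (m / 2 * (2 + r ^ 2))
        * Real.exp (m / 2 * r ^ 2 + c ^ 2 / (2 * m)) * Real.exp (-(m * r ^ 2))) := by ring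
    _ = (N.factorial : ℝ) * (2 / m) ^ N * (Real.exp m * Real.exp (c ^ 2 / (2 * m))) := by
        rw [← Real.exp_add, ← Real.exp_add, ← Real.exp_add]
        congr 2
        ring
    _ = _ := by ring

/-- The quadratic form `∑ (a_k / 4) (Z_{2k-1}² + Z_{2k}²)`. -/
def quad (a : Fin n → ℝ) (Z : Space n) : ℝ := ∑ i, a i.1 / 4 * Z i ^ 2

theorem exists_quad_ge (a : Fin n → ℝ) (ha : ∀ k, 0 < a k) :
    ∃ m : ℝ, 0 < m ∧ ∀ Z : Space n, m * ‖Z‖ ^ 2 ≤ quad a Z := by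
  obtain ⟨m, hm, hma⟩ : ∃ m : ℝ, 0 < m ∧ ∀ k, m ≤ a k := by
    rcases isEmpty_or_nonempty (Fin n) with h | h
    · exact ⟨1, one_pos, fun k => h.elim k⟩
    · obtain ⟨k, hk⟩ := Finite.exists_min a
      exact ⟨a k, ha k, hk⟩
  refine ⟨m / 4, by positivity, fun Z => ?_⟩
  rw [EuclideanSpace.norm_sq_eq, quad, Finset.mul_sum]
  refine Finset.sum_le_sum fun i _ => ?_
  rw [Real.norm_eq_abs, sq_abs]
  have := hma i.1
  gcongr

theorem hasTemperateGrowth_quad (a : Fin n → ℝ) : (quad a).HasTemperateGrowth := by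
  have h (i : Fin n × Fin 2) : (fun Z : Space n => Z i).HasTemperateGrowth :=
    (EuclideanSpace.proj i : Space n →L[ℝ] ℝ).hasTemperateGrowth
  unfold quad
  refine Function.HasTemperateGrowth.sum fun i _ => ?_
  exact (Function.HasTemperateGrowth.const _).mul ((h i).pow 2)

theorem norm_iteratedFDeriv_rexp (i : ℕ) (y : ℝ) : ‖iteratedFDeriv ℝ i Real.exp y‖ = Real.exp y := by
  rw [norm_iteratedFDeriv_eq_norm_iteratedDeriv, iteratedDeriv_eq_iterate, Real.iter_deriv_exp,
    Real.norm_eq_abs, Real.abs_exp]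

/-- The Gaussian `exp (-∑ (a_k / 4) (Z_{2k-1}² + Z_{2k}²))` as a real Schwartz function. -/
def realGaussian (a : Fin n → ℝ) (ha : ∀ k, 0 < a k) : 𝓢(Space n, ℝ) where
  toFun Z := Real.exp (-quad a Z)
  smooth' := (Real.contDiff_exp.comp (hasTemperateGrowth_quad a).1.neg)
  decay' k l := by
    obtain ⟨m, hm, hmq⟩ := exists_quad_ge a ha
    obtain ⟨p, C, hC, hp⟩ :=
      (hasTemperateGrowth_quad a).neg.norm_iteratedFDeriv_le_uniform l
    obtain ⟨B, hB⟩ := exists_pow_mul_exp_le (k + p * l) 0 hm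
    refine ⟨l.factorial * (1 + C) ^ l * B, fun Z => ?_⟩
    have hZ : 0 ≤ ‖Z‖ := norm_nonneg Z
    -- The composition bound needs the `i`-th derivative of `quad` to be at most `D ^ i`. Taking `1
    -- + C` in place of `C` makes `D ≥ 1`, so a uniform bound by `D` suffices.
    have key := norm_iteratedFDeriv_comp_le (n := l) (N := ((⊤ : ℕ∞) : WithTop ℕ∞)) (g := Real.exp) (f := -quad a)
      Real.contDiff_exp (hasTemperateGrowth_quad a).1.neg (by exact_mod_cast le_top) Z
      (C := Real.exp (-quad a Z)) (D := (1 + C) * (1 + ‖Z‖) ^ p)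
      (fun i _ => (norm_iteratedFDeriv_rexp i _).le) (fun i hi hil => by
        refine (hp i hil Z).trans ?_
        calc C * (1 + ‖Z‖) ^ p ≤ (1 + C) * (1 + ‖Z‖) ^ p := by gcongr; linarith
          _ ≤ _ := le_self_pow₀ (one_le_mul_of_one_le_of_one_le (by linarith)
            (one_le_pow₀ (by linarith))) (by omega))
    change ‖Z‖ ^ k * ‖iteratedFDeriv ℝ l (Real.exp ∘ (-quad a)) Z‖ ≤ _
    have h1 : Real.exp (-quad a Z) ≤ Real.exp (-(m * ‖Z‖ ^ 2)) :=
      Real.exp_le_exp.2 (neg_le_neg (hmq Z))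
    calc ‖Z‖ ^ k * ‖iteratedFDeriv ℝ l (Real.exp ∘ (-quad a)) Z‖
        ≤ (1 + ‖Z‖) ^ k * (l.factorial * Real.exp (-(m * ‖Z‖ ^ 2))
            * ((1 + C) * (1 + ‖Z‖) ^ p) ^ l) := by
          gcongr
          · linarith
          · exact key.trans (by gcongr)
      _ = l.factorial * (1 + C) ^ l
            * ((1 + ‖Z‖) ^ (k + p * l) * Real.exp (0 * ‖Z‖) * Real.exp (-(m * ‖Z‖ ^ 2))) := by
          rw [zero_mul, Real.exp_zero, mul_pow, pow_add, pow_mul]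
          ring
      _ ≤ _ := by
          gcongr
          exact hB _ hZ

theorem realGaussian_apply (a : Fin n → ℝ) (ha : ∀ k, 0 < a k) (Z : Space n) :
    realGaussian a ha Z = Real.exp (-quad a Z) := rfl

/-- The vector valued Gaussians `Z ↦ exp (-∑ (a_k / 4) (Z_{2k-1}² + Z_{2k}²)) v`. -/
def gaussVec (V : Type*) [NormedAddCommGroup V] [InnerProductSpace ℂ V] (a : Fin n → ℝ)
    (ha : ∀ k, 0 < a k) : V →ₗ[ℂ] 𝓢(Space n, V) where
  toFun v := SchwartzMap.postcompCLM (ContinuousLinearMap.toSpanSingleton ℝ v) (realGaussian a ha)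
  map_add' v w := by
    ext Z
    simp
  map_smul' c v := by
    ext Z
    simp [smul_comm (realGaussian a ha Z) c v]

@[simp]
theorem gaussVec_apply (a : Fin n → ℝ) (ha : ∀ k, 0 < a k) (v : V) (Z : Space n) :
    gaussVec V a ha v Z = (Real.exp (-quad a Z) : ℂ) • v := by
  rw [Complex.coe_smul]
  simp [gaussVec, realGaussian_apply]

/-- The coordinate function `Z_i`. -/
def coordLin (i : Fin n × Fin 2) : Space n →ₗ[ℝ] ℂ :=
  Complex.ofRealCLM.toLinearMap ∘ₗ (EuclideanSpace.proj i : Space n →L[ℝ] ℝ).toLinearMap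

@[simp]
theorem coordLin_apply (i : Fin n × Fin 2) (Z : Space n) : coordLin i Z = (Z i : ℂ) := rfl

theorem coordLin_basisVec (i j : Fin n × Fin 2) :
    coordLin i (basisVec j) = if i = j then 1 else 0 := by
  by_cases h : i = j <;> simp [basisVec, h]

theorem mulLin_eq_sum (F : Space n →ₗ[ℝ] ℂ) (ψ : 𝓢(Space n, V)) :
    mulLin V F ψ = ∑ i, F (basisVec i) • mulLin V (coordLin i) ψ := by
  ext Z
  have hF : F Z = ∑ i, F (basisVec i) * (Z i : ℂ) := by
    conv_lhs => rw [eq_sum_basisVec Z, map_sum]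
    simp [mul_comm]
  simp only [mulLin_apply, hF, Finset.sum_smul, mul_smul, sum_apply,
    smul_apply, coordLin_apply]

theorem hasFDerivAt_quad (a : Fin n → ℝ) (Z : Space n) :
    HasFDerivAt (quad a) (∑ i, (a i.1 / 2 * Z i) • (EuclideanSpace.proj i : Space n →L[ℝ] ℝ)) Z := by
  have h (i : Fin n × Fin 2) : HasFDerivAt (fun Z : Space n => a i.1 / 4 * Z i ^ 2)
      ((a i.1 / 2 * Z i) • (EuclideanSpace.proj i : Space n →L[ℝ] ℝ)) Z := by
    have h0 : HasFDerivAt (fun Z : Space n => Z i) (EuclideanSpace.proj i : Space n →L[ℝ] ℝ) Z :=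
      (EuclideanSpace.proj i : Space n →L[ℝ] ℝ).hasFDerivAt
    refine ((h0.pow 2).const_mul (a i.1 / 4)).congr_fderiv ?_
    ext W
    simp
    ring
  exact HasFDerivAt.fun_sum fun i _ => h i

/-- The linear function `(a_k / 2) Z_i + i α_i`, minus the logarithmic covariant derivative of the
Gaussian. -/
def logLin (a : Fin n → ℝ) (i : Fin n × Fin 2) : Space n →ₗ[ℝ] ℂ :=
  ((a i.1 : ℂ) / 2) • coordLin i + Complex.I • potentialLin a i

theorem covDeriv_gaussVec (a : Fin n → ℝ) (ha : ∀ k, 0 < a k) (i : Fin n × Fin 2) (v : V) :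
    covDeriv a i (gaussVec V a ha v) = -mulLin V (logLin a i) (gaussVec V a ha v) := by
  ext Z
  have h1 : (gaussVec V a ha v : Space n → V) = fun Z => Real.exp (-quad a Z) • v := by
    funext Z
    rw [gaussVec_apply, Complex.ofReal_exp, ← Complex.ofReal_exp, Complex.coe_smul]
  have h2 := (((hasFDerivAt_quad a Z).fun_neg).exp).smul_const v
  have h3 : (∑ j, (a j.1 / 2 * Z j) • (EuclideanSpace.proj j : Space n →L[ℝ] ℝ)) (basisVec i)
      = a i.1 / 2 * Z i := by
    simp [basisVec]
  rw [covDeriv_apply, h1, h2.fderiv]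
  simp only [ContinuousLinearMap.smulRight_apply, smul_apply,
    neg_apply, h3, mulLin_apply, gaussVec_apply]
  simp only [logLin, LinearMap.add_apply, LinearMap.smul_apply, coordLin_apply, potentialLin,
    LinearMap.coe_mk, AddHom.coe_mk, smul_eq_mul, ← Complex.coe_smul, smul_smul]
  push_cast
  module

/-- With `∇_i g = -L_i g`, the Leibniz rule gives `H g = ∑ L_i(e_i) g - ∑ L_i² g`. In each plane the
two forms `L_i` differ by the factor `i`, so their squares cancel, and the divergence is `∑ a_k`. -/
theorem magneticLaplacian_gaussVec (a : Fin n → ℝ) (ha : ∀ k, 0 < a k) (v : V) :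
    magneticLaplacian a (gaussVec V a ha v) = ((∑ k, a k : ℝ) : ℂ) • gaussVec V a ha v := by
  have h0 : ∑ i : Fin n × Fin 2, logLin a i (basisVec i) = ((∑ k, a k : ℝ) : ℂ) := by
    rw [Fintype.sum_prod_type]
    push_cast
    refine Finset.sum_congr rfl fun k _ => ?_
    simp [logLin, coordLin_basisVec, potentialLin_basisVec, -coordLin_apply]
  have h1 : ∑ i : Fin n × Fin 2, mulLin V (logLin a i) (mulLin V (logLin a i) (gaussVec V a ha v))
      = 0 := by
    ext Z
    simp only [sum_apply, mulLin_apply, smul_smul, ← Finset.sum_smul,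
      zero_apply, gaussVec_apply]
    have : ∑ i : Fin n × Fin 2, logLin a i Z * (logLin a i Z * (Real.exp (-quad a Z) : ℂ)) = 0 := by
      rw [Fintype.sum_prod_type]
      refine Finset.sum_eq_zero fun k _ => ?_
      simp [Fin.sum_univ_two, logLin, potentialLin, potential]
      linear_combination (Complex.exp (-(quad a Z : ℂ)) * ((a k : ℂ) / 2) ^ 2
        * ((Z (k, 0) : ℂ) ^ 2 + (Z (k, 1) : ℂ) ^ 2)) * Complex.I_sq
    rw [this, zero_smul]
  simp only [magneticLaplacian_apply, covDeriv_gaussVec, map_neg, covDeriv_mulLin,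
    Finset.sum_neg_distrib, Finset.sum_add_distrib, neg_neg, h1, ← Finset.sum_smul, h0]
  simp

/-! ### Polynomials times the Gaussian -/

/-- The polynomials of degree at most `d` with values in `V`, times the Gaussian. -/
def polyGauss (V : Type*) [NormedAddCommGroup V] [InnerProductSpace ℂ V] (a : Fin n → ℝ)
    (ha : ∀ k, 0 < a k) : ℕ → Submodule ℂ 𝓢(Space n, V)
  | 0 => LinearMap.range (gaussVec V a ha)
  | d + 1 => polyGauss V a ha d ⊔ ⨆ i, (polyGauss V a ha d).map (mulLin V (coordLin i))

theorem polyGauss_le_succ (a : Fin n → ℝ) (ha : ∀ k, 0 < a k) (d : ℕ) :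
    polyGauss V a ha d ≤ polyGauss V a ha (d + 1) := le_sup_left

theorem polyGauss_succ_le (a : Fin n → ℝ) (ha : ∀ k, 0 < a k) (d : ℕ)
    {W : Submodule ℂ 𝓢(Space n, V)} (h0 : polyGauss V a ha d ≤ W)
    (h1 : ∀ i, ∀ η ∈ polyGauss V a ha d, mulLin V (coordLin i) η ∈ W) :
    polyGauss V a ha (d + 1) ≤ W :=
  sup_le h0 (iSup_le fun i => Submodule.map_le_iff_le_comap.2 fun η hη => h1 i η hη)

instance finiteDimensional_polyGauss [FiniteDimensional ℂ V] (a : Fin n → ℝ) (ha : ∀ k, 0 < a k)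
    (d : ℕ) : FiniteDimensional ℂ (polyGauss V a ha d) := by
  induction d with
  | zero => exact inferInstanceAs (FiniteDimensional ℂ (LinearMap.range (gaussVec V a ha)))
  | succ d ih =>
    exact inferInstanceAs (FiniteDimensional ℂ
      (polyGauss V a ha d ⊔ ⨆ i, (polyGauss V a ha d).map (mulLin V (coordLin i)) :
        Submodule ℂ 𝓢(Space n, V)))

theorem mulLin_mem_polyGauss (a : Fin n → ℝ) (ha : ∀ k, 0 < a k) (F : Space n →ₗ[ℝ] ℂ) {d : ℕ}
    {η : 𝓢(Space n, V)} (hη : η ∈ polyGauss V a ha d) :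
    mulLin V F η ∈ polyGauss V a ha (d + 1) := by
  rw [mulLin_eq_sum]
  refine Submodule.sum_mem _ fun i _ => Submodule.smul_mem _ _ ?_
  exact (le_iSup (fun i => (polyGauss V a ha d).map (mulLin V (coordLin i))) i |>.trans
    le_sup_right) (Submodule.mem_map_of_mem hη)

theorem pow_mulLin_gaussVec_mem (a : Fin n → ℝ) (ha : ∀ k, 0 < a k) (F : Space n →ₗ[ℝ] ℂ) (v : V)
    (d : ℕ) : (mulLin V F ^ d) (gaussVec V a ha v) ∈ polyGauss V a ha d := by
  induction d with
  | zero => exact ⟨v, rfl⟩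
  | succ d ih =>
    rw [pow_succ']
    exact mulLin_mem_polyGauss a ha F ih

theorem covDeriv_mem_polyGauss (a : Fin n → ℝ) (ha : ∀ k, 0 < a k) (j : Fin n × Fin 2) (d : ℕ) :
    polyGauss V a ha d ≤ (polyGauss V a ha (d + 1)).comap (covDeriv a j) := by
  induction d with
  | zero =>
    rintro _ ⟨v, rfl⟩
    rw [Submodule.mem_comap, covDeriv_gaussVec]
    exact Submodule.neg_mem _ (mulLin_mem_polyGauss a ha _ ⟨v, rfl⟩)
  | succ d ih =>
    refine polyGauss_succ_le a ha d (ih.trans (Submodule.comap_mono (polyGauss_le_succ a ha _)))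
      fun i η hη => ?_
    rw [Submodule.mem_comap, covDeriv_mulLin]
    exact Submodule.add_mem _ (mulLin_mem_polyGauss a ha _ (ih hη)) (Submodule.smul_mem _ _
      (polyGauss_le_succ a ha _ (polyGauss_le_succ a ha _ hη)))

/-- A second-order operator could raise the degree by two. It does not: the ground state is an
eigenvector, and the commutator with a coordinate is `-2 ∇_i`, which raises the degree by at most
one. -/
theorem magneticLaplacian_mem_polyGauss (a : Fin n → ℝ) (ha : ∀ k, 0 < a k) (d : ℕ) :
    polyGauss V a ha d ≤ (polyGauss V a ha d).comap (magneticLaplacian a) := by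
  induction d with
  | zero =>
    rintro _ ⟨v, rfl⟩
    rw [Submodule.mem_comap, magneticLaplacian_gaussVec]
    exact Submodule.smul_mem _ _ ⟨v, rfl⟩
  | succ d ih =>
    refine polyGauss_succ_le a ha d (ih.trans (Submodule.comap_mono (polyGauss_le_succ a ha _)))
      fun i η hη => ?_
    rw [Submodule.mem_comap, magneticLaplacian_mulLin]
    exact Submodule.sub_mem _ (mulLin_mem_polyGauss a ha _ (ih hη)) (Submodule.smul_mem _ _
      (Submodule.sum_mem _ fun j _ => Submodule.smul_mem _ _ (covDeriv_mem_polyGauss a ha j d hη)))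

/-- The magnetic Laplacian is diagonalizable on the polynomials times the Gaussian. -/
theorem polyGauss_le_span_eigenvectors [FiniteDimensional ℂ V] (a : Fin n → ℝ)
    (ha : ∀ k, 0 < a k) (d : ℕ) :
    polyGauss V a ha d
      ≤ Submodule.span ℂ {η | ∃ μ : ℝ, magneticLaplacian a η = (μ : ℂ) • η} := by
  -- The space is transported into `L²` to acquire an inner product, so that the finite-dimensional
  -- spectral theorem applies.
  let e := (polyGauss V a ha d).equivMapOfInjective (emb : 𝓢(Space n, V) →ₗ[ℂ] L2 n V) emb_injective
  let H := (magneticLaplacian a : 𝓢(Space n, V) →ₗ[ℂ] 𝓢(Space n, V)).restrict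
    (magneticLaplacian_mem_polyGauss a ha d)
  let T := e.toLinearMap ∘ₗ H ∘ₗ e.symm.toLinearMap
  have he (η : polyGauss V a ha d) : (e η : L2 n V) = emb (η : 𝓢(Space n, V)) := rfl
  have hT : T.IsSymmetric := by
    intro x y
    obtain ⟨η, rfl⟩ := e.surjective x
    obtain ⟨ζ, rfl⟩ := e.surjective y
    simp only [T, LinearMap.comp_apply, LinearEquiv.coe_coe, LinearEquiv.symm_apply_apply,
      Submodule.coe_inner, he]
    exact inner_magneticLaplacian_left a _ _
  let b := hT.eigenvectorBasis rfl
  have hb (i) : ∃ μ : ℝ, magneticLaplacian a (e.symm (b i) : 𝓢(Space n, V))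
      = (μ : ℂ) • (e.symm (b i) : 𝓢(Space n, V)) := by
    refine ⟨hT.eigenvalues rfl i, ?_⟩
    have h := congrArg e.symm (hT.apply_eigenvectorBasis rfl i)
    simp only [T, LinearMap.comp_apply, LinearEquiv.coe_coe, LinearEquiv.symm_apply_apply,
      map_smul] at h
    exact congrArg Subtype.val h
  intro η hη
  have h1 : (⟨η, hη⟩ : polyGauss V a ha d) = ∑ i, b.repr (e ⟨η, hη⟩) i • e.symm (b i) := by
    apply e.injective
    simp only [map_sum, map_smul, LinearEquiv.apply_symm_apply]
    exact (b.sum_repr _).symm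
  have h2 : η = ∑ i, b.repr (e ⟨η, hη⟩) i • (e.symm (b i) : 𝓢(Space n, V)) := by
    have := congrArg Subtype.val h1
    simpa using this
  rw [h2]
  exact Submodule.sum_mem _ fun i _ => Submodule.smul_mem _ _ (Submodule.subset_span (hb i))

end Gaussian

/-! ### Moment determinacy and totality of polynomials times the Gaussian -/

section Determinacy

open scoped FourierTransform InnerProductSpace

/-- An integrable function with vanishing Fourier transform vanishes almost everywhere. -/
theorem ae_eq_zero_of_fourier_eq_zero {E V : Type*} [NormedAddCommGroup E] [InnerProductSpace ℝ E]
    [FiniteDimensional ℝ E] [MeasurableSpace E] [BorelSpace E] [NormedAddCommGroup V]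
    [NormedSpace ℂ V] [CompleteSpace V] {h : E → V} (hi : Integrable h) (h0 : ∀ w, 𝓕 h w = 0) :
    h =ᵐ[volume] 0 := by
  refine ae_eq_zero_of_integral_contDiff_smul_eq_zero hi.locallyIntegrable fun g hg hgs => ?_
  let ψ : 𝓢(E, ℂ) := (hgs.comp_left Complex.ofReal_zero : HasCompactSupport
    (Complex.ofReal ∘ g)).toSchwartzMap (Complex.ofRealCLM.contDiff.comp hg)
  have hψ (x : E) : ψ x = (g x : ℂ) := rfl
  -- A test function `g` is the Fourier transform of a Schwartz function, and the transform can be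
  -- moved from it onto `h`, where it vanishes.
  have key := VectorFourier.integral_fourierIntegral_smul_eq_flip (L := innerₗ E)
    (μ := volume) (ν := volume) Real.continuous_fourierChar continuous_inner
    (𝓕⁻ ψ).integrable hi
  have h1 (x : E) : VectorFourier.fourierIntegral Real.fourierChar volume (innerₗ E)
      (𝓕⁻ ψ : 𝓢(E, ℂ)) x = (g x : ℂ) := by
    have h2 : (𝓕 (𝓕⁻ ψ) : 𝓢(E, ℂ)) x = (g x : ℂ) := by
      rw [FourierTransform.fourier_fourierInv_eq, hψ]
    exact h2
  have h3 (x : E) : VectorFourier.fourierIntegral Real.fourierChar volume (innerₗ E).flip h x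
      = 0 := by
    rw [flip_innerₗ]
    exact h0 x
  simpa only [h1, h3, smul_zero, integral_zero, Complex.coe_smul] using key

/-- A function with exponential decay all of whose moments vanish is zero almost everywhere. -/
theorem ae_eq_zero_of_moments {E V : Type*} [NormedAddCommGroup E] [InnerProductSpace ℝ E]
    [FiniteDimensional ℝ E] [MeasurableSpace E] [BorelSpace E] [NormedAddCommGroup V]
    [NormedSpace ℂ V] [CompleteSpace V] {h : E → V}
    (hi : ∀ c : ℝ, Integrable fun Z => Real.exp (c * ‖Z‖) • h Z)
    (hm : ∀ (ξ : E) (m : ℕ), ∫ Z, ((⟪Z, ξ⟫_ℝ : ℝ) : ℂ) ^ m • h Z = 0) : h =ᵐ[volume] 0 := by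
  have hi0 : Integrable h := by simpa using hi 0
  refine ae_eq_zero_of_fourier_eq_zero hi0 fun ξ => ?_
  rw [Real.fourier_eq]
  let κ : ℂ := -2 * Real.pi * Complex.I
  have hκ : ‖κ‖ = 2 * Real.pi := by simp [κ, abs_of_pos Real.pi_pos]
  -- The Fourier kernel is expanded in its exponential series and integrated term by term, dominated
  -- by `exp (2π ‖ξ‖ ‖Z‖) ‖h Z‖`; each term is a moment.
  have hsum := hasSum_integral_of_dominated_convergence (μ := (volume : Measure E))
    (F := fun (m : ℕ) Z => ((κ * ⟪Z, ξ⟫_ℝ) ^ m / (m.factorial : ℂ)) • h Z)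
    (f := fun Z => Complex.exp (κ * ⟪Z, ξ⟫_ℝ) • h Z)
    (fun m Z => (2 * Real.pi * ‖ξ‖ * ‖Z‖) ^ m / (m.factorial : ℝ) * ‖h Z‖)
    (fun m => ((by fun_prop : Continuous fun Z : E =>
      (κ * ⟪Z, ξ⟫_ℝ) ^ m / (m.factorial : ℂ)).aestronglyMeasurable).smul
        hi0.aestronglyMeasurable)
    (fun m => Filter.Eventually.of_forall fun Z => by
      rw [norm_smul, norm_div, norm_pow, norm_mul, hκ, Complex.norm_real, Complex.norm_natCast]
      have : ‖⟪Z, ξ⟫_ℝ‖ ≤ ‖ξ‖ * ‖Z‖ := (norm_inner_le_norm Z ξ).trans_eq (mul_comm _ _)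
      have hp := Real.pi_pos.le
      rw [mul_assoc (2 * Real.pi)]
      gcongr)
    (Filter.Eventually.of_forall fun Z => (Real.summable_pow_div_factorial _).mul_right _)
    (by
      have h1 : (fun Z : E => ∑' m : ℕ, (2 * Real.pi * ‖ξ‖ * ‖Z‖) ^ m / (m.factorial : ℝ) * ‖h Z‖)
          = fun Z => ‖Real.exp (2 * Real.pi * ‖ξ‖ * ‖Z‖) • h Z‖ := by
        funext Z
        rw [tsum_mul_right, norm_smul, Real.norm_eq_abs, Real.abs_exp, Real.exp_eq_exp_ℝ,
          NormedSpace.exp_eq_tsum_div]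
      rw [h1]
      exact (hi _).norm)
    (Filter.Eventually.of_forall fun Z => by
      have h1 := NormedSpace.expSeries_div_hasSum_exp (κ * ⟪Z, ξ⟫_ℝ : ℂ)
      rw [← Complex.exp_eq_exp_ℂ] at h1
      exact h1.smul_const (h Z))
  have hz (m : ℕ) : ∫ Z, ((κ * ⟪Z, ξ⟫_ℝ) ^ m / (m.factorial : ℂ)) • h Z = 0 := by
    have : (fun Z => ((κ * ⟪Z, ξ⟫_ℝ) ^ m / (m.factorial : ℂ)) • h Z)
        = fun Z => (κ ^ m / (m.factorial : ℂ)) • (((⟪Z, ξ⟫_ℝ : ℝ) : ℂ) ^ m • h Z) := by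
      funext Z
      rw [smul_smul, mul_pow]
      congr 1
      ring
    rw [this, integral_smul, hm, smul_zero]
  simp only [hz] at hsum
  have h2 := hsum.unique hasSum_zero
  rw [← h2]
  refine integral_congr_ae (Filter.Eventually.of_forall fun Z => ?_)
  simp only [Circle.smul_def, Real.fourierChar_apply]
  congr 2
  simp only [κ]
  push_cast
  ring

variable {n : ℕ} {V : Type*} [NormedAddCommGroup V] [InnerProductSpace ℂ V]

/-- The Gaussian is split into two equal factors: one bounds the growing weight, the other is a
Schwartz function and so lies in `L²`. -/
theorem memLp_gaussian_weight (a : Fin n → ℝ) (ha : ∀ k, 0 < a k) (c : ℝ) :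
    MemLp (fun Z : Space n => (1 + ‖Z‖) * Real.exp (c * ‖Z‖) * Real.exp (-quad a Z)) 2 := by
  have ha2 : ∀ k, 0 < a k / 2 := fun k => by linarith [ha k]
  obtain ⟨m, hm, hmq⟩ := exists_quad_ge (fun k => a k / 2) ha2
  obtain ⟨C, hC⟩ := exists_pow_mul_exp_le 1 c hm
  have hq (Z : Space n) : quad a Z = quad (fun k => a k / 2) Z + quad (fun k => a k / 2) Z := by
    simp only [quad, ← Finset.sum_add_distrib]
    exact Finset.sum_congr rfl fun i _ => by ring
  have hcont : Continuous (quad a) := (hasTemperateGrowth_quad a).1.continuous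
  refine MemLp.of_le_mul (c := C) ((realGaussian _ ha2).memLp 2 volume)
    (by fun_prop : Continuous _).aestronglyMeasurable (Filter.Eventually.of_forall fun Z => ?_)
  rw [realGaussian_apply, hq, neg_add, Real.exp_add, ← mul_assoc, norm_mul]
  gcongr
  rw [Real.norm_of_nonneg (by positivity)]
  refine le_trans ?_ (hC ‖Z‖ (norm_nonneg Z))
  rw [pow_one]
  have := hmq Z
  gcongr

/-- Hölder's inequality for two `L²` factors. The factor `f` of linear growth allows determinacy to
be applied to `F u` before `F u` is known to be square integrable. -/
theorem integrable_gaussian_smul (a : Fin n → ℝ) (ha : ∀ k, 0 < a k) (c : ℝ)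
    {f : Space n → ℂ} (hf : Continuous f) {K : ℝ} (hK : ∀ Z, ‖f Z‖ ≤ K * (1 + ‖Z‖))
    {u : Space n → V} (hu : MemLp u 2) :
    Integrable fun Z => Real.exp (c * ‖Z‖) • (Real.exp (-quad a Z) • (f Z • u Z)) := by
  have hcont : Continuous (quad a) := (hasTemperateGrowth_quad a).1.continuous
  have h1 : MemLp (fun Z : Space n => ((Real.exp (c * ‖Z‖) * Real.exp (-quad a Z) : ℝ) : ℂ) * f Z)
      2 := by
    refine MemLp.of_le_mul (c := K) (memLp_gaussian_weight a ha c)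
      (by fun_prop : Continuous _).aestronglyMeasurable (Filter.Eventually.of_forall fun Z => ?_)
    rw [norm_mul, Complex.norm_real, Real.norm_of_nonneg (by positivity),
      Real.norm_of_nonneg (by positivity)]
    calc _ ≤ Real.exp (c * ‖Z‖) * Real.exp (-quad a Z) * (K * (1 + ‖Z‖)) := by gcongr; exact hK Z
      _ = _ := by ring
  have h2 : MemLp (fun Z => (((Real.exp (c * ‖Z‖) * Real.exp (-quad a Z) : ℝ) : ℂ) * f Z) • u Z)
      1 := hu.smul h1
  rw [memLp_one_iff_integrable] at h2
  refine h2.congr (Filter.Eventually.of_forall fun Z => ?_)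
  simp only [mul_smul, Complex.coe_smul, Complex.ofReal_mul]

/-- A function of Gaussian-controlled growth which is orthogonal to all polynomials times the
Gaussian vanishes. -/
theorem ae_eq_zero_of_inner_polyGauss [FiniteDimensional ℂ V] (a : Fin n → ℝ) (ha : ∀ k, 0 < a k)
    {w : Space n → V}
    (hw : ∀ c : ℝ, Integrable fun Z => Real.exp (c * ‖Z‖) • (Real.exp (-quad a Z) • w Z))
    (h : ∀ (d : ℕ), ∀ η ∈ polyGauss V a ha d, ∫ Z, inner ℂ (η Z) (w Z) = 0) :
    w =ᵐ[volume] 0 := by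
  have : CompleteSpace V := FiniteDimensional.complete ℂ V
  have h0 := ae_eq_zero_of_moments hw fun ξ m => ?_
  · filter_upwards [h0] with Z hZ
    exact (smul_eq_zero.1 hZ).resolve_left (Real.exp_pos _).ne'
  refine ext_inner_left ℂ fun v => ?_
  let F : Space n →ₗ[ℝ] ℂ := Complex.ofRealCLM.toLinearMap ∘ₗ (innerₗ (Space n) ξ)
  have hF (Z : Space n) : F Z = ((⟪Z, ξ⟫_ℝ : ℝ) : ℂ) := by
    simp [F, real_inner_comm]
  have hη (Z : Space n) : ((mulLin V F ^ m) (gaussVec V a ha v)) Z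
      = (((⟪Z, ξ⟫_ℝ : ℝ) : ℂ) ^ m * (Real.exp (-quad a Z) : ℂ)) • v := by
    induction m with
    | zero => simp
    | succ m ih =>
      rw [pow_succ', Module.End.mul_apply, mulLin_apply, ih, hF, smul_smul, pow_succ', mul_assoc]
  -- Since `|⟨Z, ξ⟩| ^ m ≤ m! ‖ξ‖ ^ m exp ‖Z‖`, the case `c = 1` of the hypothesis dominates.
  have hint : Integrable fun Z => ((⟪Z, ξ⟫_ℝ : ℝ) : ℂ) ^ m • (Real.exp (-quad a Z) • w Z) := by
    refine Integrable.mono' (g := fun Z => ‖(m.factorial * ‖ξ‖ ^ m) • Real.exp (1 * ‖Z‖)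
      • (Real.exp (-quad a Z) • w Z)‖) ((hw 1).smul _).norm ?_ ?_
    · have := (hw 0).aestronglyMeasurable
      simp only [zero_mul, Real.exp_zero, one_smul] at this
      exact ((by fun_prop : Continuous fun Z : Space n =>
        ((⟪Z, ξ⟫_ℝ : ℝ) : ℂ) ^ m).aestronglyMeasurable).smul this
    · refine Filter.Eventually.of_forall fun Z => ?_
      rw [norm_smul, norm_smul _ (Real.exp (1 * ‖Z‖) • _), norm_smul (Real.exp (1 * ‖Z‖)),
        ← mul_assoc, norm_pow, Complex.norm_real, Real.norm_of_nonneg (by positivity : (0 : ℝ) ≤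
          m.factorial * ‖ξ‖ ^ m), Real.norm_of_nonneg (Real.exp_pos (1 * ‖Z‖)).le, one_mul]
      gcongr
      have h1 := Real.pow_div_factorial_le_exp _ (norm_nonneg Z) m
      rw [div_le_iff₀ (by positivity)] at h1
      calc ‖⟪Z, ξ⟫_ℝ‖ ^ m ≤ (‖Z‖ * ‖ξ‖) ^ m := by
            gcongr
            exact norm_inner_le_norm Z ξ
        _ = ‖Z‖ ^ m * ‖ξ‖ ^ m := mul_pow _ _ _
        _ ≤ (Real.exp ‖Z‖ * m.factorial) * ‖ξ‖ ^ m := by gcongr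
        _ = _ := by ring
  rw [inner_zero_right, ← integral_inner hint, ← h m _ (pow_mulLin_gaussVec_mem a ha F v m)]
  refine integral_congr_ae (Filter.Eventually.of_forall fun Z => ?_)
  simp only [hη, inner_smul_left, inner_smul_right, ← Complex.coe_smul (Real.exp _), map_mul,
    map_pow, Complex.conj_ofReal]
  ring

end Determinacy

/-! ### Weak eigenfunctions, the projection and Toeplitz operators -/

section Eigenspace

variable {n : ℕ} {V : Type*} [NormedAddCommGroup V] [InnerProductSpace ℂ V]

theorem emb_mem_eigenspace {a : Fin n → ℝ} {Λ : ℝ} {η : 𝓢(Space n, V)}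
    (h : magneticLaplacian a η = (Λ : ℂ) • η) : emb η ∈ eigenspace V a Λ := by
  intro ψ
  change inner ℂ (emb (magneticLaplacian a ψ)) (emb η) = _ * inner ℂ (emb ψ) (emb η)
  rw [inner_magneticLaplacian_left, h, map_smul, inner_smul_right]

theorem inner_magneticLaplacian_of_mem {a : Fin n → ℝ} {Λ : ℝ} {φ : L2 n V}
    (h : φ ∈ eigenspace V a Λ) (ψ : 𝓢(Space n, V)) :
    inner ℂ (emb (magneticLaplacian a ψ)) φ = (Λ : ℂ) * inner ℂ (emb ψ) φ := h ψ

/-- The Schwartz eigenfunctions of the magnetic Laplacian. -/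
def schwartzEigenspace (V : Type*) [NormedAddCommGroup V] [InnerProductSpace ℂ V] (a : Fin n → ℝ)
    (Λ : ℝ) : Submodule ℂ 𝓢(Space n, V) := Module.End.eigenspace (magneticLaplacian a) (Λ : ℂ)

theorem mem_schwartzEigenspace {a : Fin n → ℝ} {Λ : ℝ} {η : 𝓢(Space n, V)} :
    η ∈ schwartzEigenspace V a Λ ↔ magneticLaplacian a η = (Λ : ℂ) • η :=
  Module.End.mem_eigenspace_iff

theorem integrable_inner_emb (ψ : 𝓢(Space n, V)) (φ : L2 n V) :
    Integrable fun Z => inner ℂ (ψ Z) (φ Z) := by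
  refine (L2.integrable_inner (𝕜 := ℂ) (emb ψ) φ).congr ?_
  filter_upwards [ψ.coeFn_toLp 2 (volume : Measure (Space n))] with Z hZ
  rw [emb_apply, hZ]

theorem inner_smul_eq_inner_mulLin (F : Space n →ₗ[ℝ] ℂ) (ψ : 𝓢(Space n, V)) (φ : L2 n V)
    (Z : Space n) :
    inner ℂ (ψ Z) (F Z • φ Z) = inner ℂ (mulLin V (conjLin F) ψ Z) (φ Z) := by
  rw [mulLin_apply, inner_smul_left, inner_smul_right, conjLin_apply, Complex.conj_conj]

theorem inner_emb_mulOp (F : Space n →ₗ[ℝ] ℂ) {φ : L2 n V} (hF : φ ∈ (mulOp V F).domain)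
    (ψ : 𝓢(Space n, V)) :
    inner ℂ (emb ψ) (mulOp V F ⟨φ, hF⟩) = inner ℂ (emb (mulLin V (conjLin F) ψ)) φ := by
  rw [inner_emb_left, inner_emb_left]
  refine integral_congr_ae ?_
  filter_upwards [MemLp.coeFn_toLp (memLp_of_mem_mulDomain hF)] with Z hZ
  rw [← inner_smul_eq_inner_mulLin, ← hZ]
  rfl

/-- The energy identity `∑ ‖∇_j η‖² = Λ ‖η‖²` bounds each summand. -/
theorem norm_covDeriv_le {a : Fin n → ℝ} {Λ : ℝ} {η : 𝓢(Space n, V)}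
    (h : magneticLaplacian a η = (Λ : ℂ) • η) (i : Fin n × Fin 2) :
    ‖emb (covDeriv a i η)‖ ≤ √|Λ| * ‖emb η‖ := by
  have h1 := inner_magneticLaplacian_self a η
  have h0 : inner ℂ (emb η) (emb η) = ((‖emb η‖ ^ 2 : ℝ) : ℂ) := by
    rw [inner_self_eq_norm_sq_to_K]
    push_cast
    rfl
  rw [h, map_smul, inner_smul_right, h0] at h1
  have h2 : Λ * ‖emb η‖ ^ 2 = ∑ j, ‖emb (covDeriv a j η)‖ ^ 2 := by exact_mod_cast h1
  have h3 : ‖emb (covDeriv a i η)‖ ^ 2 ≤ ∑ j, ‖emb (covDeriv a j η)‖ ^ 2 :=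
    Finset.single_le_sum (f := fun j => ‖emb (covDeriv a j η)‖ ^ 2)
      (fun j _ => by positivity) (Finset.mem_univ i)
  refine le_of_sq_le_sq ?_ (by positivity)
  rw [mul_pow, Real.sq_sqrt (abs_nonneg _)]
  calc _ ≤ Λ * ‖emb η‖ ^ 2 := h3.trans_eq h2.symm
    _ ≤ |Λ| * ‖emb η‖ ^ 2 := by gcongr; exact le_abs_self Λ

variable [FiniteDimensional ℂ V]

/-! ### The spectral projection -/

theorem spectralProj_mem (a : Fin n → ℝ) (Λ : ℝ) (φ : L2 n V) :
    spectralProj V a Λ φ ∈ eigenspace V a Λ :=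
  Submodule.starProjection_apply_mem _ φ

theorem spectralProj_of_mem {a : Fin n → ℝ} {Λ : ℝ} {φ : L2 n V} (h : φ ∈ eigenspace V a Λ) :
    spectralProj V a Λ φ = φ :=
  Submodule.starProjection_eq_self_iff.2 h

theorem spectralProj_eq_zero {a : Fin n → ℝ} {Λ : ℝ} {φ : L2 n V}
    (h : ∀ χ ∈ eigenspace V a Λ, inner ℂ φ χ = 0) : spectralProj V a Λ φ = 0 :=
  (Submodule.starProjection_apply_eq_zero_iff _).2
    ((Submodule.mem_orthogonal' _ _).2 h)

theorem inner_spectralProj_left (a : Fin n → ℝ) (Λ : ℝ) (φ χ : L2 n V) :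
    inner ℂ (spectralProj V a Λ φ) χ = inner ℂ φ (spectralProj V a Λ χ) :=
  Submodule.inner_starProjection_left_eq_right _ φ χ

theorem spectralProj_emb_of_ne {a : Fin n → ℝ} {Λ μ : ℝ} {η : 𝓢(Space n, V)}
    (h : magneticLaplacian a η = (μ : ℂ) • η) (hμ : μ ≠ Λ) : spectralProj V a Λ (emb η) = 0 := by
  refine spectralProj_eq_zero fun χ hχ => ?_
  have h1 := inner_magneticLaplacian_of_mem hχ η
  rw [h, map_smul, inner_smul_left, Complex.conj_ofReal] at h1
  have h2 : ((μ : ℂ) - Λ) * inner ℂ (emb η) χ = 0 := by rw [sub_mul, h1, sub_self]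
  exact (mul_eq_zero.1 h2).resolve_left (sub_ne_zero.2 (by exact_mod_cast hμ))

/-- The polynomials times the Gaussian are total in `L²`. -/
theorem eq_zero_of_inner_polyGauss (a : Fin n → ℝ) (ha : ∀ k, 0 < a k) {x : L2 n V}
    (h : ∀ d, ∀ η ∈ polyGauss V a ha d, inner ℂ (emb η) x = 0) : x = 0 := by
  rw [Lp.eq_zero_iff_ae_eq_zero]
  refine ae_eq_zero_of_inner_polyGauss a ha (fun c => ?_) fun d η hη => ?_
  · have := integrable_gaussian_smul a ha c (f := fun _ => 1) continuous_const (K := 1)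
      (fun Z => by simp) (Lp.memLp x)
    simpa using this
  · rw [← inner_emb_left]
    exact h d η hη

theorem ext_inner_emb (a : Fin n → ℝ) (ha : ∀ k, 0 < a k) {x y : L2 n V}
    (h : ∀ d, ∀ η ∈ polyGauss V a ha d, inner ℂ (emb η) x = inner ℂ (emb η) y) : x = y := by
  rw [← sub_eq_zero]
  refine eq_zero_of_inner_polyGauss a ha fun d η hη => ?_
  rw [inner_sub_right, h d η hη, sub_self]

/-- The spectral projection maps polynomials times the Gaussian to Schwartz eigenfunctions. -/
theorem exists_spectralProj_eq_emb (a : Fin n → ℝ) (ha : ∀ k, 0 < a k) (Λ : ℝ) {d : ℕ}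
    {η : 𝓢(Space n, V)} (hη : η ∈ polyGauss V a ha d) :
    ∃ ζ : 𝓢(Space n, V), magneticLaplacian a ζ = (Λ : ℂ) • ζ ∧
      spectralProj V a Λ (emb η) = emb ζ := by
  refine Submodule.span_induction ?_ ?_ ?_ ?_ (polyGauss_le_span_eigenvectors a ha d hη)
  · rintro η ⟨μ, h⟩
    by_cases hμ : μ = Λ
    · subst hμ
      exact ⟨η, h, spectralProj_of_mem (emb_mem_eigenspace h)⟩
    · exact ⟨0, by simp, by rw [spectralProj_emb_of_ne h hμ, map_zero]⟩
  · exact ⟨0, by simp, by simp⟩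
  · rintro _ _ _ _ ⟨ζ, h1, h2⟩ ⟨ζ', h1', h2'⟩
    exact ⟨ζ + ζ', by rw [map_add, h1, h1', smul_add], by rw [map_add, map_add, h2, h2', map_add]⟩
  · rintro c _ _ ⟨ζ, h1, h2⟩
    exact ⟨c • ζ, by rw [map_smul, h1, smul_comm], by rw [map_smul, map_smul, h2, map_smul]⟩

/-- Let `ρ` be orthogonal to the Schwartz eigenfunctions. For a polynomial times the Gaussian `η`,
the vector `P η` is such an eigenfunction, so `⟨η, P ρ⟩ = ⟨P η, ρ⟩ = 0`. Totality gives `P ρ = 0`.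
-/
theorem eigenspace_le_closure (a : Fin n → ℝ) (ha : ∀ k, 0 < a k) (Λ : ℝ) :
    eigenspace V a Λ ≤ ((schwartzEigenspace V a Λ).map emb).topologicalClosure := by
  have : CompleteSpace V := FiniteDimensional.complete ℂ V
  rw [← Submodule.orthogonal_orthogonal_eq_closure]
  intro φ hφ
  rw [Submodule.mem_orthogonal]
  intro ρ hρ
  have h0 : spectralProj V a Λ ρ = 0 := by
    refine eq_zero_of_inner_polyGauss a ha fun d η hη => ?_
    obtain ⟨ζ, h1, h2⟩ := exists_spectralProj_eq_emb a ha Λ hη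
    rw [← inner_spectralProj_left, h2]
    exact (Submodule.mem_orthogonal _ _).1 hρ _
      (Submodule.mem_map_of_mem (mem_schwartzEigenspace.2 h1))
  rw [← spectralProj_of_mem hφ, ← inner_spectralProj_left, h0, inner_zero_left]

/-- Here `(H - Λ)(Z_i η) = -2 ∇_i η`, and anything of the form `(H - Λ) ψ` with `ψ` Schwartz is
orthogonal to the weak eigenspace. -/
theorem spectralProj_covDeriv {a : Fin n → ℝ} {Λ : ℝ} {η : 𝓢(Space n, V)}
    (h : magneticLaplacian a η = (Λ : ℂ) • η) (i : Fin n × Fin 2) :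
    spectralProj V a Λ (emb (covDeriv a i η)) = 0 := by
  refine spectralProj_eq_zero fun χ hχ => ?_
  have h1 := inner_magneticLaplacian_of_mem hχ (mulLin V (coordLin i) η)
  have h2 : ∑ j, coordLin i (basisVec j) • covDeriv a j η = covDeriv a i η := by
    simp [coordLin_basisVec, -coordLin_apply]
  rw [magneticLaplacian_mulLin, h, h2, map_smul, map_sub, map_smul, map_smul, inner_sub_left,
    inner_smul_left, inner_smul_left, Complex.conj_ofReal, sub_eq_self] at h1
  simpa using h1

/-- The eigenfunctions have square integrable covariant derivatives, which are orthogonal to the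
eigenspace. -/
theorem exists_weak_covDeriv (a : Fin n → ℝ) (ha : ∀ k, 0 < a k) {Λ : ℝ} {φ : L2 n V}
    (hφ : φ ∈ eigenspace V a Λ) (i : Fin n × Fin 2) :
    ∃ δ : L2 n V, spectralProj V a Λ δ = 0 ∧
      ∀ ψ : 𝓢(Space n, V), inner ℂ (emb ψ) δ = -inner ℂ (emb (covDeriv a i ψ)) φ := by
  have : CompleteSpace V := FiniteDimensional.complete ℂ V
  obtain ⟨x, hx, hlim⟩ := mem_closure_iff_seq_limit.1 (eigenspace_le_closure a ha Λ hφ)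
  choose η hη hηx using hx
  have hη' (m) : magneticLaplacian a (η m) = (Λ : ℂ) • η m := mem_schwartzEigenspace.1 (hη m)
  have hlim' : Filter.Tendsto (fun m => emb (η m)) Filter.atTop (nhds φ) := by
    simpa only [hηx] using hlim
  have hc : CauchySeq fun m => emb (covDeriv a i (η m)) := by
    have h1 := hlim'.cauchySeq
    rw [Metric.cauchySeq_iff] at h1 ⊢
    intro ε hε
    -- The energy bound is applied to differences; the `+ 1` keeps the denominator positive when `Λ
    -- = 0`.
    obtain ⟨N, hN⟩ := h1 (ε / (√|Λ| + 1)) (by positivity)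
    refine ⟨N, fun m hm l hl => ?_⟩
    have h2 := hN m hm l hl
    rw [dist_eq_norm, ← map_sub] at h2 ⊢
    rw [← map_sub]
    have h3 : magneticLaplacian a (η m - η l) = (Λ : ℂ) • (η m - η l) := by
      rw [map_sub, hη', hη', smul_sub]
    calc _ ≤ √|Λ| * ‖emb (η m - η l)‖ := norm_covDeriv_le h3 i
      _ ≤ (√|Λ| + 1) * ‖emb (η m - η l)‖ := by gcongr; linarith
      _ < (√|Λ| + 1) * (ε / (√|Λ| + 1)) := by gcongr
      _ = ε := by field_simp
  obtain ⟨δ, hδ⟩ := cauchySeq_tendsto_of_complete hc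
  refine ⟨δ, ?_, fun ψ => ?_⟩
  · have h1 := ((spectralProj V a Λ).continuous.tendsto δ).comp hδ
    have h2 : (spectralProj V a Λ : L2 n V → L2 n V) ∘ (fun m => emb (covDeriv a i (η m)))
        = fun _ => 0 := funext fun m => spectralProj_covDeriv (hη' m) i
    rw [h2] at h1
    exact tendsto_nhds_unique h1 tendsto_const_nhds
  · have h1 : Filter.Tendsto (fun m => inner ℂ (emb ψ) (emb (covDeriv a i (η m)))) Filter.atTop
        (nhds (inner ℂ (emb ψ) δ)) := tendsto_const_nhds.inner hδ
    have h2 : Filter.Tendsto (fun m => -inner ℂ (emb (covDeriv a i ψ)) (emb (η m))) Filter.atTop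
        (nhds (-inner ℂ (emb (covDeriv a i ψ)) φ)) := (tendsto_const_nhds.inner hlim').neg
    simp only [inner_covDeriv_left, neg_neg] at h2
    exact tendsto_nhds_unique h1 h2

/-- The vector `δ` is `i ∇_{X_F} φ` in the weak sense, built from the weak covariant derivatives,
each of which the projection kills. -/
theorem exists_guiding_eq (a : Fin n → ℝ) (ha : ∀ k, 0 < a k) {Λ : ℝ} {φ : L2 n V}
    (hφ : φ ∈ eigenspace V a Λ) (F : Space n →ₗ[ℝ] ℂ) :
    ∃ δ : L2 n V, spectralProj V a Λ δ = 0 ∧ ∀ ψ : 𝓢(Space n, V),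
      inner ℂ (emb (guiding V a (conjLin F) ψ)) φ
        = inner ℂ (emb (mulLin V (conjLin F) ψ)) φ + inner ℂ (emb ψ) δ := by
  choose δ hδ hψ using exists_weak_covDeriv a ha hφ
  refine ⟨∑ i, (Complex.I * hamLin a F i) • δ i, by simp [hδ], fun ψ => ?_⟩
  simp only [guiding_apply, map_add, map_sum, map_smul, inner_add_left, sum_inner, inner_sum,
    inner_smul_left, inner_smul_right, hψ, hamLin_conjLin, map_mul, Complex.conj_I,
    Complex.conj_conj]
  congr 1
  exact Finset.sum_congr rfl fun i _ => by ring

/-! ### Toeplitz operators with linear symbols -/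

/-- On its domain, the Toeplitz operator with linear symbol `F` is the weak realization of the
guiding centre operator of `F`. -/
theorem inner_spectralProj_mulOp (a : Fin n → ℝ) (ha : ∀ k, 0 < a k) {Λ : ℝ} {φ : L2 n V}
    (hφ : φ ∈ eigenspace V a Λ) (F : Space n →ₗ[ℝ] ℂ) (hF : φ ∈ (mulOp V F).domain)
    (ψ : 𝓢(Space n, V)) :
    inner ℂ (emb ψ) (spectralProj V a Λ (mulOp V F ⟨φ, hF⟩))
      = inner ℂ (emb (guiding V a (conjLin F) ψ)) φ := by
  obtain ⟨δ, hδ, hψ⟩ := exists_guiding_eq a ha hφ F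
  have h1 (ψ : 𝓢(Space n, V)) : inner ℂ (emb ψ) (mulOp V F ⟨φ, hF⟩ + δ)
      = inner ℂ (emb (guiding V a (conjLin F) ψ)) φ := by
    rw [inner_add_right, inner_emb_mulOp, hψ]
  -- `F φ + δ` is the guiding centre operator applied weakly to `φ`. As that operator commutes with
  -- `H`, the sum is again an eigenfunction, hence fixed by the projection, which annihilates `δ`.
  have h2 : mulOp V F ⟨φ, hF⟩ + δ ∈ eigenspace V a Λ := by
    intro ψ
    change inner ℂ (emb (magneticLaplacian a ψ)) _ = _ * inner ℂ (emb ψ) _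
    rw [h1, h1, ← magneticLaplacian_guiding a ha, inner_magneticLaplacian_of_mem hφ]
  rw [← h1, ← spectralProj_of_mem h2, map_add, hδ, add_zero]

/-- Weak form of the commutation of guiding centre operators with `P`. Since `P ψ` need not be known
to be Schwartz, `P` is moved onto `η`, which may be taken to be an eigenvector: both it and its
image are fixed, or both are killed. -/
theorem inner_guiding_spectralProj (a : Fin n → ℝ) (ha : ∀ k, 0 < a k) (Λ : ℝ)
    (F : Space n →ₗ[ℝ] ℂ) (ψ : 𝓢(Space n, V)) {d : ℕ} {η : 𝓢(Space n, V)}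
    (hη : η ∈ polyGauss V a ha d) :
    inner ℂ (emb (guiding V a (conjLin F) η)) (spectralProj V a Λ (emb ψ))
      = inner ℂ (emb η) (spectralProj V a Λ (emb (guiding V a F ψ))) := by
  refine Submodule.span_induction ?_ ?_ ?_ ?_ (polyGauss_le_span_eigenvectors a ha d hη)
  · rintro η ⟨μ, h⟩
    have h' : magneticLaplacian a (guiding V a (conjLin F) η)
        = (μ : ℂ) • guiding V a (conjLin F) η := by
      rw [magneticLaplacian_guiding a ha, h, map_smul]
    rw [← inner_spectralProj_left, ← inner_spectralProj_left]
    by_cases hμ : μ = Λ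
    · subst hμ
      rw [spectralProj_of_mem (emb_mem_eigenspace h), spectralProj_of_mem (emb_mem_eigenspace h'),
        inner_guiding_left, conjLin_conjLin]
    · rw [spectralProj_emb_of_ne h hμ, spectralProj_emb_of_ne h' hμ, inner_zero_left,
        inner_zero_left]
  · simp
  · intro x y _ _ hx hy
    simp only [map_add, inner_add_left, hx, hy]
  · intro c x _ hx
    simp only [map_smul, inner_smul_left, hx]

/-- For `u = P ψ`, the candidate for `F u` is the guiding centre operator minus `i ∇_{X_F}`, namely
`g`, which lies in `L²`. Equality of `F u` and `g` is checked against polynomials times the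
Gaussian; determinacy needs only Gaussian-weighted integrability. -/
theorem spectralProj_emb_mem_mulDomain (a : Fin n → ℝ) (ha : ∀ k, 0 < a k) (Λ : ℝ)
    (F : Space n →ₗ[ℝ] ℂ) (ψ : 𝓢(Space n, V)) :
    spectralProj V a Λ (emb ψ) ∈ (mulOp V F).domain := by
  set u := spectralProj V a Λ (emb ψ) with hu
  obtain ⟨δ, -, hδ⟩ := exists_guiding_eq a ha (spectralProj_mem a Λ (emb ψ)) F
  set g := spectralProj V a Λ (emb (guiding V a F ψ)) - δ with hg
  have hFc : Continuous F := F.continuous_of_finiteDimensional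
  have hFb (Z : Space n) : ‖F Z‖ ≤ ‖F.toContinuousLinearMap‖ * (1 + ‖Z‖) :=
    (F.toContinuousLinearMap.le_opNorm Z).trans (by gcongr; linarith)
  have h0 : (fun Z => F Z • u Z - g Z) =ᵐ[volume] 0 := by
    refine ae_eq_zero_of_inner_polyGauss a ha (fun c => ?_) fun d η hη => ?_
    · have h1 := integrable_gaussian_smul a ha c hFc hFb (Lp.memLp u)
      have h2 := integrable_gaussian_smul a ha c (f := fun _ => 1) continuous_const (K := 1)
        (fun Z => by simp) (Lp.memLp g)
      refine (h1.sub h2).congr (Filter.Eventually.of_forall fun Z => ?_)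
      simp only [Pi.sub_apply, smul_sub, one_smul]
    · simp only [inner_sub_right, inner_smul_eq_inner_mulLin]
      rw [integral_sub (integrable_inner_emb _ u) (integrable_inner_emb _ g), ← inner_emb_left,
        ← inner_emb_left, hg, inner_sub_right, ← inner_guiding_spectralProj a ha Λ F ψ hη, hδ]
      ring
  change MemLp (fun Z => F Z • u Z) 2 volume
  refine (Lp.memLp g).ae_eq ?_
  filter_upwards [h0] with Z hZ
  exact (sub_eq_zero.1 hZ).symm

theorem spectralProj_mulOp_emb (a : Fin n → ℝ) (ha : ∀ k, 0 < a k) (Λ : ℝ)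
    (F : Space n →ₗ[ℝ] ℂ) (ψ : 𝓢(Space n, V)) :
    spectralProj V a Λ (mulOp V F ⟨_, spectralProj_emb_mem_mulDomain a ha Λ F ψ⟩)
      = spectralProj V a Λ (emb (guiding V a F ψ)) := by
  refine ext_inner_emb a ha fun d η hη => ?_
  rw [inner_spectralProj_mulOp a ha (spectralProj_mem a Λ _), inner_guiding_spectralProj a ha Λ F ψ hη]

theorem mem_toeplitz_domain {a : Fin n → ℝ} {Λ : ℝ} {F : Space n → ℂ} {Φ : L2 n V} :
    Φ ∈ (toeplitz V a Λ F).domain ↔ spectralProj V a Λ Φ ∈ (mulOp V F).domain :=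
  ⟨fun ⟨⟨_, h⟩, _⟩ => h, fun h => ⟨⟨trivial, h⟩, trivial⟩⟩

theorem toeplitz_apply {a : Fin n → ℝ} {Λ : ℝ} {F : Space n → ℂ} {Φ : L2 n V}
    (h : Φ ∈ (toeplitz V a Λ F).domain) :
    toeplitz V a Λ F ⟨Φ, h⟩
      = spectralProj V a Λ (mulOp V F ⟨spectralProj V a Λ Φ, mem_toeplitz_domain.1 h⟩) := rfl

theorem inner_toeplitz (a : Fin n → ℝ) (ha : ∀ k, 0 < a k) {Λ : ℝ} (F : Space n →ₗ[ℝ] ℂ)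
    {Φ : L2 n V} (h : Φ ∈ (toeplitz V a Λ F).domain) (ψ : 𝓢(Space n, V)) :
    inner ℂ (emb ψ) (toeplitz V a Λ F ⟨Φ, h⟩)
      = inner ℂ (emb (guiding V a (conjLin F) ψ)) (spectralProj V a Λ Φ) := by
  rw [toeplitz_apply, inner_spectralProj_mulOp a ha (spectralProj_mem a Λ Φ)]

/-- Passing to adjoints reverses the order of the factors. The intermediate projection drops out
because the range of a Toeplitz operator lies in the eigenspace. -/
theorem inner_toeplitz_toeplitz (a : Fin n → ℝ) (ha : ∀ k, 0 < a k) {Λ : ℝ}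
    (F G : Space n →ₗ[ℝ] ℂ) {Φ : L2 n V}
    (h : Φ ∈ (pmul (toeplitz V a Λ F) (toeplitz V a Λ G)).domain) (ψ : 𝓢(Space n, V)) :
    inner ℂ (emb ψ) (pmul (toeplitz V a Λ F) (toeplitz V a Λ G) ⟨Φ, h⟩)
      = inner ℂ (emb (guiding V a (conjLin G) (guiding V a (conjLin F) ψ)))
          (spectralProj V a Λ Φ) := by
  obtain ⟨h1, h2⟩ := id h
  change inner ℂ (emb ψ) (toeplitz V a Λ F ⟨toeplitz V a Λ G ⟨Φ, h1⟩, h2⟩) = _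
  rw [inner_toeplitz a ha, ← inner_toeplitz a ha G h1]
  congr 1
  rw [toeplitz_apply]
  exact spectralProj_of_mem (spectralProj_mem a Λ _)

/-- The Toeplitz operator sends a Schwartz `ψ` to `P` of the Schwartz function obtained from the
guiding centre operator, so the domain criterion applies a second time. -/
theorem emb_mem_pmul_toeplitz_domain (a : Fin n → ℝ) (ha : ∀ k, 0 < a k) (Λ : ℝ)
    (F G : Space n →ₗ[ℝ] ℂ) (ψ : 𝓢(Space n, V)) :
    emb ψ ∈ (pmul (toeplitz V a Λ F) (toeplitz V a Λ G)).domain := by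
  refine ⟨mem_toeplitz_domain.2 (spectralProj_emb_mem_mulDomain a ha Λ G ψ),
    mem_toeplitz_domain.2 ?_⟩
  rw [toeplitz_apply, spectralProj_mulOp_emb a ha, spectralProj_of_mem (spectralProj_mem a Λ _)]
  exact spectralProj_emb_mem_mulDomain a ha Λ F _

end Eigenspace

end Landau

end

theorem mainTheorem4 {n : ℕ} {V : Type*} [NormedAddCommGroup V] [InnerProductSpace ℂ V]
    [FiniteDimensional ℂ V] (a : Fin n → ℝ) (ha : ∀ k, 0 < a k)
    (Λ : ℝ) (hΛ : Λ ∈ Landau.landauLevels a)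
    (F G : Landau.Space n →ₗ[ℝ] ℂ) :
    ∃ c : ℂ,
      (∀ Z : Landau.Space n, Landau.poissonBracket a F G Z = c) ∧
      (∀ ψ : 𝓢(Landau.Space n, V), ψ.toLp 2 volume ∈
        (Landau.commutator (Landau.toeplitz V a Λ F) (Landau.toeplitz V a Λ G)).domain) ∧
      (∀ Φ : (Landau.commutator (Landau.toeplitz V a Λ F) (Landau.toeplitz V a Λ G)).domain,
        Landau.commutator (Landau.toeplitz V a Λ F) (Landau.toeplitz V a Λ G) Φ
          = (Complex.I * c) • Landau.spectralProj V a Λ (Φ : Landau.L2 n V)) := by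
  refine ⟨Landau.bracketLin a F G, Landau.poissonBracket_eq_bracketLin a F G, fun ψ => ?_,
    fun ⟨Φ, hΦ⟩ => ?_⟩
  · exact ⟨Landau.emb_mem_pmul_toeplitz_domain a ha Λ F G ψ,
      Landau.emb_mem_pmul_toeplitz_domain a ha Λ G F ψ⟩
  · refine Landau.ext_inner_emb a ha fun d η _ => ?_
    change inner ℂ _ (Landau.pmul (Landau.toeplitz V a Λ F) (Landau.toeplitz V a Λ G) ⟨Φ, hΦ.1⟩
      - Landau.pmul (Landau.toeplitz V a Λ G) (Landau.toeplitz V a Λ F) ⟨Φ, hΦ.2⟩) = _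
    -- With `c = {F, G}_a`, the reversed order and conjugated symbols give the scalar `-i` times the
    -- conjugate of `c` in the left slot; conjugate linearity turns it into `i c`.
    rw [inner_sub_right,
      Landau.inner_toeplitz_toeplitz a ha, Landau.inner_toeplitz_toeplitz a ha, ← inner_sub_left,
      ← map_sub, Landau.guiding_comm a ha, Landau.bracketLin_swap, Landau.bracketLin_conjLin,
      map_smul, inner_smul_left, inner_smul_right]
    simp
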